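/- Let $0<\alpha,\delta,\gamma<1$ be fixed and put $\alpha'=\gamma\alpha$. Along a sequence indexed by $n$ (suppressed below) let $d,s$ be positive integers with $s\le d$, $d,s\to\infty$, and let $a,\sigma>0$. One observes $X\sim N(\theta,\sigma^2 I_d)$, where $$\theta\in\Theta^+(s,a)=\{\theta\in\mathbb R^d:\ \|\theta\|_0\le s,\ \theta_j\ge a\text{ whenever }\theta_j\ne0\}.$$ **Confidence sets.** A sparse confidence set is $M=M(S,U,L)=\{\theta:\ \theta_j=0\ (j\notin S),\ L_j\le\theta_j\le U_j\ (j\in S)\}$, where $S\subseteq\{1,\dots,d\}$ and $L_j,U_j$ are measurable functions of $X$. Let $CI_+$ be the class of those for which $L_j,U_j$ depend only on $X_j$, with $0\le L_j\le \max(X_j,0)$ and $U_j=+\infty$ if $j\in S$, and $L_j=U_j=0$ if $j\notin S$. Write $S\in\mathcal F(\delta)$ if for every $j$ the event $\{j\in S\}$ depends only on $X_j$ and has probability at most $1-\delta$ when $X_j\sim N(0,\sigma^2)$. The risk is $$R(M)=\sup_{1\le j\le d}\ \sup_{\theta\in\Theta^+(s,a)}\mathbb E_\theta(\theta_j-L_j)\in(-\infty,+\infty].$$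 $\mathcal M_+$ denotes the class of sequences of confidence sets $M$ that, for all large $n$, lie in $CI_+$ and have $S\in\mathcal F(\delta)$, and that satisfy $\liminf\inf_{\theta\in\Theta^+(s,a)}\mathbb P_\theta(\theta\in M)\ge1-\alpha$. For $c\ge 0$ let $\mathcal M_+^{c}$ be the class, at a given $n$, of the $M\in CI_+$ with $S\in\mathcal F(\delta)$ and $\inf_{\theta\in\Theta^+(s,a)}\mathbb P_\theta(\theta\in M)\ge c$. **The proposed set.** Let $\Phi$ be the standard normal distribution function, $C_{x,\beta}=2\sqrt{\pi\log(x/\beta)}$, and $$\kappa^{**}=\Phi^{-1}(\delta)+\sqrt{2\log\tfrac{s}{C_{s,\alpha'}\alpha'}},\qquad t=\sqrt{2\log\tfrac{2(d-s)}{(\alpha-\alpha')C_{d-s,\alpha-\alpha'}}},\qquad \bar\kappa=t+\sqrt{2\log\tfrac{s}{C_{s,\alpha'}\alpha'}}.$$ The set $\bar M_{\alpha'}$ has $\bar L_j=\max(X_j-\bar u\sigma,0)$, $\bar U_j=+\infty$ for $j\in\bar S$ and $\bar L_j=\bar U_j=0$ for $j\notin\bar S$, where * if $a/\sigma<\bar\kappa$: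 $j\in\bar S\iff X_j/\sigma\ge\Phi^{-1}(\delta)$, and $\bar u=\sqrt{2\log\frac{d}{(\alpha-\alpha')C_{d,\alpha-\alpha'}}}$; * if $a/\sigma\ge\bar\kappa$: $j\in\bar S\iff X_j/\sigma\ge t$, and $\bar u=\sqrt{2\log\frac{2s}{(\alpha-\alpha')C_{s,\alpha-\alpha'}}}$. **(1) Moderate SNR.** Suppose that for all large $n$, $\kappa^{**}\le a/\sigma\le\sqrt{2\log(d/A-1)}$ for some real sequence $A$ with $A\le s$, $A\to\infty$, $d/A\to\infty$. Then for every $M\in\mathcal M_+$, and more uniformly for every sequence $c$ with $\liminf c\ge1-\alpha$, $$\liminf\frac{R(M)}{\sigma\sqrt{2\log d}/2}\ge1,\qquad \liminf\ \inf_{M\in\mathcal M_+^{c}}\frac{R(M)}{\sigma\sqrt{2\log d}/2}\ge1.$$ If moreover $s<d$ for all large $n$, then $\bar M_{\alpha'}\in\mathcal M_+$ and $\displaystyle\limsup\frac{R(\bar M_{\alpha'})}{\sigma\sqrt{2\log d}}\le1$. **(2) High SNR.** There is a constant $C_0>0$, depending only on $\alpha,\delta,\gamma$, such that for every $C'\ge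 C_0$ the following holds. Suppose that $d-s\to\infty$ and that for all large $n$, $a/\sigma\ge\tilde\kappa$, where $$\tilde\kappa=\sqrt{2\log(d-s)-\log\log(d-s)+C'}+\max\Big(\sqrt{2\log s-\log\log s+C'},\ \xi\Big),\quad \xi=\sqrt{\max(\log\log(d-s)-\log\log s,\,0)}.$$ Then for every $M\in\mathcal M_+$, and more uniformly for every sequence $c$ with $\liminf c\ge1-\alpha$, $$\liminf\frac{R(M)}{\sigma\sqrt{2\log s}/2}\ge1,\qquad \liminf\ \inf_{M\in\mathcal M_+^{c}}\frac{R(M)}{\sigma\sqrt{2\log s}/2}\ge1,$$ and $\bar M_{\alpha'}\in\mathcal M_+$ with $\displaystyle\limsup\frac{R(\bar M_{\alpha'})}{\sigma\sqrt{2\log s}}\le1$. In both regimes $\bar M_{\alpha'}$ is therefore optimal within $\mathcal M_+$ up to a factor $2$. -/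

import Mathlib

open MeasureTheory ProbabilityTheory Filter Topology
open scoped ENNReal NNReal

noncomputable section

namespace SparseCI

/-- The standard normal cumulative distribution function `Φ`. -/
def Phi (x : ℝ) : ℝ := cdf (gaussianReal 0 1) x

/-- The standard normal quantile function; on `(0, 1)` it is the inverse function of `Phi`. -/
def PhiInv (p : ℝ) : ℝ := sInf {x : ℝ | p ≤ Phi x}

/-- The law `N(θ, σ² I)` of the observation in `ℝ^d`: independent coordinates
`X_j ~ N(θ_j, σ²)`. -/
def normalMean {d : ℕ} (σ : ℝ) (θ : Fin d → ℝ) : Measure (Fin d → ℝ) :=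
  Measure.pi fun j => gaussianReal (θ j) ⟨σ ^ 2, sq_nonneg σ⟩

/-- The one-sided sparse parameter space `Θ⁺(s, a)`. -/
def ThetaPlus (d s : ℕ) (a : ℝ) : Set (Fin d → ℝ) :=
  {θ | {j | θ j ≠ 0}.ncard ≤ s ∧ ∀ j, θ j ≠ 0 → a ≤ θ j}

/-- The data `(S, U, L)` of a sparse confidence set: a random index set and random upper and lower
bounds, all of them measurable functions of the observation `x`. -/
structure SparseConfSet (d : ℕ) where
  S : (Fin d → ℝ) → Set (Fin d)
  L : (Fin d → ℝ) → Fin d → ℝ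
  U : (Fin d → ℝ) → Fin d → EReal
  measurable_S : ∀ j, MeasurableSet {x | j ∈ S x}
  measurable_L : ∀ j, Measurable fun x => L x j
  measurable_U : ∀ j, Measurable fun x => U x j

namespace SparseConfSet

variable {d : ℕ}

/-- The confidence set `M(S, U, L) ⊆ ℝ^d` at the observation `x`: coordinates outside `S` vanish,
and coordinates in `S` lie in `[L_j, U_j]`. -/
def region (M : SparseConfSet d) (x : Fin d → ℝ) : Set (Fin d → ℝ) :=
  {θ | (∀ j, j ∉ M.S x → θ j = 0) ∧
    ∀ j, j ∈ M.S x → M.L x j ≤ θ j ∧ (θ j : EReal) ≤ M.U x j}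

/-- The minimal coverage probability `inf_{θ ∈ Θ⁺(s,a)} P_θ(θ ∈ M)`. -/
def coverage (M : SparseConfSet d) (s : ℕ) (a σ : ℝ) : ℝ≥0∞ :=
  ⨅ θ ∈ ThetaPlus d s a, normalMean σ θ {x | θ ∈ M.region x}

/-- The risk `R(M, Θ⁺(s,a)) = sup_j sup_{θ ∈ Θ⁺(s,a)} E_θ (θ_j - L_j)`, possibly `+∞`. -/
def risk (M : SparseConfSet d) (s : ℕ) (a σ : ℝ) : EReal :=
  ⨆ j : Fin d, ⨆ θ ∈ ThetaPlus d s a, ((∫ x, (θ j - M.L x j) ∂(normalMean σ θ) : ℝ) : EReal)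

/-- The class `CI₊` of separable one-sided sparse confidence sets. -/
def IsOneSided (M : SparseConfSet d) : Prop :=
  (∀ j x y, x j = y j → M.L x j = M.L y j ∧ M.U x j = M.U y j) ∧
  (∀ x j, j ∈ M.S x → 0 ≤ M.L x j ∧ M.L x j ≤ max (x j) 0 ∧ M.U x j = ⊤) ∧
  (∀ x j, j ∉ M.S x → M.L x j = 0 ∧ M.U x j = 0)

/-- The condition `S ∈ F(δ)`: the event `{j ∈ S}` depends on `X_j` only, and
`P(j ∈ S) ≤ 1 - δ` when `X_j ~ N(0, σ²)`. -/
def SelectsAt (M : SparseConfSet d) (σ δ : ℝ) : Prop :=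
  (∀ j x y, x j = y j → (j ∈ M.S x ↔ j ∈ M.S y)) ∧
  ∀ j, (normalMean σ (0 : Fin d → ℝ)).real {x | j ∈ M.S x} ≤ 1 - δ

end SparseConfSet

/-- The confidence sets in `CI₊` with `S ∈ F(δ)` whose minimal coverage probability over
`Θ⁺(s,a)` is at least `c`. -/
def coverageClass (d s : ℕ) (a σ δ : ℝ) (c : ℝ≥0∞) : Set (SparseConfSet d) :=
  {M | M.IsOneSided ∧ M.SelectsAt σ δ ∧ c ≤ M.coverage s a σ}

/-- The asymptotic class `𝓜₊`. Its members are sequences of confidence sets, one for each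
`(d n, s n, a n, σ n)`; the conditions are required for all large `n`, resp. in the limit. -/
def MPlus (d s : ℕ → ℕ) (a σ : ℕ → ℝ) (α δ : ℝ) : Set (∀ n, SparseConfSet (d n)) :=
  {M | (∀ᶠ n in atTop, (M n).IsOneSided ∧ (M n).SelectsAt (σ n) δ) ∧
    ENNReal.ofReal (1 - α) ≤ liminf (fun n => (M n).coverage (s n) (a n) (σ n)) atTop}

/-- The constant `C_{x,β} = 2 (π log (x/β))^{1/2}`. -/
def Cc (x β : ℝ) : ℝ := 2 * √(Real.pi * Real.log (x / β))

/-- The lower cut-off `κ**` for the signal-to-noise ratio. -/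
def kappaStarStar (s : ℕ) (δ α' : ℝ) : ℝ :=
  PhiInv δ + √(2 * Real.log (s / (Cc s α' * α')))

/-- The high signal-to-noise ratio selection threshold. -/
def highThreshold (d s : ℕ) (α α' : ℝ) : ℝ :=
  √(2 * Real.log (2 * ((d : ℝ) - s) / ((α - α') * Cc ((d : ℝ) - s) (α - α'))))

/-- The cut-off `κ̄` between the two constructions. -/
def kappaBar (d s : ℕ) (α α' : ℝ) : ℝ :=
  highThreshold d s α α' + √(2 * Real.log (s / (Cc s α' * α')))

open Classical in
/-- The selection threshold of the proposed set: `j ∈ S̄` iff `X_j / σ ≥ selThreshold`. -/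
def selThreshold (d s : ℕ) (a σ α α' δ : ℝ) : ℝ :=
  if a / σ < kappaBar d s α α' then PhiInv δ else highThreshold d s α α'

open Classical in
/-- The half-width `ū` of the proposed set. -/
def uBar (d s : ℕ) (a σ α α' : ℝ) : ℝ :=
  if a / σ < kappaBar d s α α' then √(2 * Real.log (d / ((α - α') * Cc d (α - α'))))
  else √(2 * Real.log (2 * s / ((α - α') * Cc s (α - α'))))

theorem measurableSet_threshold {d : ℕ} (t σ : ℝ) (j : Fin d) :
    MeasurableSet {x : Fin d → ℝ | t ≤ x j / σ} :=
  measurableSet_le measurable_const (by fun_prop)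

open Classical in
/-- The proposed confidence set `M̄_{α'}`: `S̄ = {j : X_j / σ ≥ selThreshold}`, with
`L̄_j = (X_j - ū σ)₊`, `Ū_j = +∞` for `j ∈ S̄`, and `L̄_j = Ū_j = 0` for `j ∉ S̄`. -/
def MBar (d s : ℕ) (a σ α α' δ : ℝ) : SparseConfSet d where
  S x := {j | selThreshold d s a σ α α' δ ≤ x j / σ}
  L x j := if selThreshold d s a σ α α' δ ≤ x j / σ
    then max (x j - uBar d s a σ α α' * σ) 0 else 0
  U x j := if selThreshold d s a σ α α' δ ≤ x j / σ then ⊤ else 0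
  measurable_S j := measurableSet_threshold _ σ j
  measurable_L j := Measurable.ite (measurableSet_threshold _ σ j)
    (by fun_prop) measurable_const
  measurable_U j := Measurable.ite (measurableSet_threshold _ σ j)
    measurable_const measurable_const

/-- The auxiliary quantity `ξ_d = ((log log (d-s) - log log s)₊)^{1/2}`. -/
def xi (d s : ℕ) : ℝ :=
  √(max (Real.log (Real.log ((d : ℝ) - s)) - Real.log (Real.log s)) 0)

/-- The high signal-to-noise ratio cut-off `κ̃` with constant `C'`. -/
def kappaTilde (d s : ℕ) (C' : ℝ) : ℝ :=
  √(2 * Real.log ((d : ℝ) - s) - Real.log (Real.log ((d : ℝ) - s)) + C') +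
    max (√(2 * Real.log s - Real.log (Real.log s) + C')) (xi d s)

end SparseCI

end

open SparseCI

/-!
Coordinates decouple and every probability is a standard normal one after the substitution
`X_j = θ_j + σ Z`.

Lower bounds. Let `m` coordinates have the same mean `b ≥ 0` and let the others vanish. The coverage
probability of this vector is at most the product of the probabilities of `L_j ≤ b` over the `m`
coordinates, so coverage bounded away from zero forces `P_b(L_j > b) ≤ K / m` for one of them
(`SparseConfSet.IsOneSided.exists_overshoot_le`). A shift of the mean by `σ τ` with
`τ = √(2 log m)` multiplies the density by at most `exp (τ² / 2 - η τ) = m exp (-η τ)` outside an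
event of probability `1 / 2 + O(η)` (`gaussianReal_shift_le`), so at mean `b + σ τ` the lower bound
`L_j` stays below `b` with probability at least `1 / 2 - o(1)`, at the cost of an error `σ τ`; on
the complementary event `L_j ≤ max(X_j, 0)` makes the error at least `-σ |Z|`
(`SparseConfSet.IsOneSided.le_risk_of_coverage`). In the moderate regime this is used with `b = 0`
and all `d` coordinates, the spike `σ √(2 log d)` being admissible because `a` does not exceed it;
in the high regime with `b = a` and `s` coordinates. All bounds depend on the confidence set only
through its coverage, which gives uniformity.

The proposed set. Coverage follows from a union bound (`le_coverage_MBar`) and Mills' bound for the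
normal tail: the constants `C_{x,β}` make `x P(Z ≥ u) → β / k` at the cut-off
`u = √(2 log (k x / (β C_{x,β})))` (`eventually_mul_gaussianTail_le`). The second branch of the
construction needs `d - s` large. In the moderate regime this holds because for `s ≥ d / 2` the
cut-off `κ̄` lies above `√(2 log d)` (`eventually_le_sub_of_moderate`), which uses `s < d` and
`π < 2 e`. The risk is at most `σ (u + (q - u)₊ P(miss))` with `u` the half-width and `q` the
selection threshold (`risk_MBar_le`); in the high regime the term `ξ` in `κ̃` keeps `q P(miss)`
bounded (`mul_gaussianTail_le_two`).
-/

namespace SparseCI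

/-! ### The standard normal distribution -/

/-- The upper tail `P(Z ≥ u)` of a standard normal variable. -/
noncomputable def gaussianTail (u : ℝ) : ℝ := (gaussianReal 0 1).real (Set.Ici u)

theorem gaussianPDFReal_std (x : ℝ) :
    gaussianPDFReal 0 1 x = (√(2 * Real.pi))⁻¹ * Real.exp (-x ^ 2 / 2) := by
  simp [gaussianPDFReal]

theorem gaussianPDFReal_std_le_one (x : ℝ) : gaussianPDFReal 0 1 x ≤ 1 := by
  rw [gaussianPDFReal_std]
  have h1 : (√(2 * Real.pi))⁻¹ ≤ 1 := by
    apply inv_le_one_of_one_le₀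
    rw [Real.one_le_sqrt]
    linarith [Real.pi_gt_three]
  have h2 : Real.exp (-x ^ 2 / 2) ≤ 1 := by
    rw [Real.exp_le_one_iff]
    nlinarith [sq_nonneg x]
  exact mul_le_one₀ h1 (Real.exp_nonneg _) h2

theorem gaussianReal_real_eq_integral (s : Set ℝ) :
    (gaussianReal 0 1).real s = ∫ x in s, gaussianPDFReal 0 1 x := by
  rw [measureReal_def, gaussianReal_apply_eq_integral 0 one_ne_zero, ENNReal.toReal_ofReal]
  exact integral_nonneg fun x => gaussianPDFReal_nonneg 0 1 x

theorem gaussianReal_std_noAtoms (x : ℝ) : (gaussianReal 0 1).real {x} = 0 := by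
  rw [gaussianReal_real_eq_integral]
  simp

theorem gaussianTail_nonneg (u : ℝ) : 0 ≤ gaussianTail u := measureReal_nonneg

theorem gaussianTail_le_one (u : ℝ) : gaussianTail u ≤ 1 := measureReal_le_one

theorem gaussianTail_anti : Antitone gaussianTail := fun _ _ h =>
  measureReal_mono (Set.Ici_subset_Ici.2 h)

theorem gaussianReal_std_Iic (u : ℝ) : (gaussianReal 0 1).real (Set.Iic (-u)) = gaussianTail u := by
  have h : (gaussianReal 0 1).map (fun x => -x) = gaussianReal 0 1 := by
    rw [gaussianReal_map_neg, neg_zero]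
  calc (gaussianReal 0 1).real (Set.Iic (-u))
      = ((gaussianReal 0 1).map (fun x => -x)).real (Set.Iic (-u)) := by rw [h]
    _ = (gaussianReal 0 1).real ((fun x => -x) ⁻¹' Set.Iic (-u)) :=
        map_measureReal_apply measurable_neg measurableSet_Iic
    _ = gaussianTail u := by
        congr 1
        ext
        simp

theorem hasDerivAt_neg_exp_neg_sq_half (x : ℝ) :
    HasDerivAt (fun x : ℝ => -Real.exp (-x ^ 2 / 2)) (x * Real.exp (-x ^ 2 / 2)) x := by
  have h : HasDerivAt (fun x : ℝ => -x ^ 2 / 2) (-x) x := by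
    refine ((hasDerivAt_pow 2 x).fun_neg.div_const 2).congr_deriv ?_
    norm_num
    ring
  exact h.exp.fun_neg.congr_deriv (by ring)

theorem tendsto_neg_exp_neg_sq_half :
    Tendsto (fun x : ℝ => -Real.exp (-x ^ 2 / 2)) atTop (𝓝 0) := by
  have h : Tendsto (fun x : ℝ => x ^ 2 / 2) atTop atTop :=
    (tendsto_pow_atTop two_ne_zero).atTop_div_const two_pos
  have := (Real.tendsto_exp_neg_atTop_nhds_zero.comp h).neg
  simpa [neg_div, Function.comp_def] using this

/-- Mills' bound: on `[u, ∞)` the density `φ(x)` is at most `(x / u) φ(x)`, whose integral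
is `φ(u) / u`. -/
theorem gaussianTail_le {u : ℝ} (hu : 0 < u) :
    gaussianTail u ≤ Real.exp (-u ^ 2 / 2) / (u * √(2 * Real.pi)) := by
  have hnn : ∀ x ∈ Set.Ioi u, 0 ≤ x * Real.exp (-x ^ 2 / 2) := fun x hx =>
    mul_nonneg (hu.trans hx).le (Real.exp_nonneg _)
  have hint : IntegrableOn (fun x : ℝ => x * Real.exp (-x ^ 2 / 2)) (Set.Ioi u) :=
    integrableOn_Ioi_deriv_of_nonneg
      (hasDerivAt_neg_exp_neg_sq_half u).continuousAt.continuousWithinAt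
      (fun x _ => hasDerivAt_neg_exp_neg_sq_half x) hnn tendsto_neg_exp_neg_sq_half
  have hval : ∫ x in Set.Ioi u, x * Real.exp (-x ^ 2 / 2) = Real.exp (-u ^ 2 / 2) := by
    rw [integral_Ioi_of_hasDerivAt_of_nonneg
      (hasDerivAt_neg_exp_neg_sq_half u).continuousAt.continuousWithinAt
      (fun x _ => hasDerivAt_neg_exp_neg_sq_half x) hnn tendsto_neg_exp_neg_sq_half]
    simp
  rw [gaussianTail, gaussianReal_real_eq_integral, integral_Ici_eq_integral_Ioi]
  calc ∫ x in Set.Ioi u, gaussianPDFReal 0 1 x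
      ≤ ∫ x in Set.Ioi u, (u * √(2 * Real.pi))⁻¹ * (x * Real.exp (-x ^ 2 / 2)) := by
        refine setIntegral_mono_on (integrable_gaussianPDFReal 0 1).integrableOn
          (hint.const_mul _) measurableSet_Ioi fun x hx => ?_
        rw [gaussianPDFReal_std, mul_inv, mul_comm u⁻¹, mul_assoc, ← mul_assoc u⁻¹]
        gcongr
        have : 1 ≤ u⁻¹ * x := by
          rw [inv_mul_eq_div, one_le_div hu]; exact (Set.mem_Ioi.1 hx).le
        exact le_mul_of_one_le_left (Real.exp_nonneg _) this
    _ = _ := by rw [integral_const_mul, hval]; ring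

theorem gaussianTail_zero_le : gaussianTail 0 ≤ 1 / 2 := by
  have h1 := gaussianReal_std_Iic 0
  rw [neg_zero] at h1
  have h2 : (gaussianReal 0 1).real (Set.Iio 0 ∪ Set.Ici 0) =
      (gaussianReal 0 1).real (Set.Iio 0) + (gaussianReal 0 1).real (Set.Ici 0) :=
    measureReal_union
      (Set.disjoint_left.2 fun x hx hx' => (not_lt.2 (Set.mem_Ici.1 hx')) (Set.mem_Iio.1 hx))
      measurableSet_Ici
  have h3 : (gaussianReal 0 1).real (Set.Iic 0) ≤
      (gaussianReal 0 1).real (Set.Iio 0) + (gaussianReal 0 1).real {0} := by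
    rw [← Set.Iio_union_right]; exact measureReal_union_le _ _
  have h4 : (gaussianReal 0 1).real (Set.Iio 0 ∪ Set.Ici 0) ≤ 1 := measureReal_le_one
  rw [gaussianReal_std_noAtoms] at h3
  have : (gaussianReal 0 1).real (Set.Ici 0) = gaussianTail 0 := rfl
  linarith

theorem gaussianTail_neg_le {η : ℝ} (hη : 0 ≤ η) : gaussianTail (-η) ≤ 1 / 2 + η := by
  have h : (gaussianReal 0 1).real (Set.Icc (-η) 0) ≤ η := by
    rw [gaussianReal_real_eq_integral]
    calc ∫ x in Set.Icc (-η) 0, gaussianPDFReal 0 1 x ≤ ∫ _ in Set.Icc (-η) 0, (1 : ℝ) :=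
          setIntegral_mono_on (integrable_gaussianPDFReal 0 1).integrableOn
            (by simp) measurableSet_Icc fun x _ => gaussianPDFReal_std_le_one x
      _ = η := by simp [hη]
  have h2 : gaussianTail (-η) ≤ (gaussianReal 0 1).real (Set.Icc (-η) 0) + gaussianTail 0 := by
    refine (measureReal_mono ?_).trans (measureReal_union_le _ _)
    intro x hx
    rcases le_total x 0 with h | h
    · exact Or.inl ⟨hx, h⟩
    · exact Or.inr h
  linarith [gaussianTail_zero_le]

/-- A Neyman–Pearson type bound: a shift by `τ` multiplies the density by at most
`exp (τ² / 2 - η τ)` outside an event of probability close to `1 / 2`. -/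
theorem gaussianReal_shift_le {B : Set ℝ} (hB : MeasurableSet B) {τ η : ℝ} (hτ : 0 ≤ τ)
    (hη : 0 ≤ η) :
    (gaussianReal 0 1).real {z | z + τ ∈ B} ≤
      1 / 2 + η + Real.exp (τ ^ 2 / 2 - η * τ) * (gaussianReal 0 1).real B := by
  have hB' : MeasurableSet {z | z + τ ∈ B} := (measurable_add_const τ) hB
  have h1 : (gaussianReal 0 1).real {z | z + τ ∈ B} ≤
      gaussianTail (-η) + (gaussianReal 0 1).real ({z | z + τ ∈ B} ∩ Set.Iio (-η)) := by
    refine (measureReal_mono ?_).trans (measureReal_union_le _ _)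
    intro x hx
    rcases le_or_gt (-η) x with h | h
    · exact Or.inl h
    · exact Or.inr ⟨hx, h⟩
  have h2 : (gaussianReal 0 1).real ({z | z + τ ∈ B} ∩ Set.Iio (-η)) ≤
      Real.exp (τ ^ 2 / 2 - η * τ) * (gaussianReal 0 1).real B := by
    rw [gaussianReal_real_eq_integral, gaussianReal_real_eq_integral, ← integral_const_mul]
    have hpre : ∫ z in {z | z + τ ∈ B}, Real.exp (τ ^ 2 / 2 - η * τ) * gaussianPDFReal 0 1 (z + τ) =
        ∫ y in B, Real.exp (τ ^ 2 / 2 - η * τ) * gaussianPDFReal 0 1 y :=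
      (measurePreserving_add_right volume τ).setIntegral_preimage_emb
        (measurableEmbedding_addRight τ)
        (fun y => Real.exp (τ ^ 2 / 2 - η * τ) * gaussianPDFReal 0 1 y) B
    rw [← hpre]
    have hint : Integrable fun z => Real.exp (τ ^ 2 / 2 - η * τ) * gaussianPDFReal 0 1 (z + τ) :=
      ((integrable_gaussianPDFReal 0 1).comp_add_right τ).const_mul _
    refine (setIntegral_mono_on (integrable_gaussianPDFReal 0 1).integrableOn hint.integrableOn
      (hB'.inter measurableSet_Iio) fun z hz => ?_).trans
      (setIntegral_mono_set hint.integrableOn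
        (ae_of_all _ fun z => mul_nonneg (Real.exp_nonneg _) (gaussianPDFReal_nonneg 0 1 _))
        (ae_of_all _ fun z hz => hz.1))
    rw [gaussianPDFReal_std, gaussianPDFReal_std, mul_left_comm, ← Real.exp_add]
    gcongr
    have : z < -η := hz.2
    nlinarith [mul_nonneg hτ (by linarith : 0 ≤ -η - z)]
  linarith [gaussianTail_neg_le hη]

theorem integrable_id_gaussianReal_std : Integrable (fun z : ℝ => z) (gaussianReal 0 1) :=
  (memLp_id_gaussianReal (μ := 0) (v := 1) 1).integrable le_rfl

theorem integral_abs_gaussianReal_std_le : ∫ z, |z| ∂(gaussianReal 0 1) ≤ 1 := by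
  have hsq : Integrable (fun z : ℝ => z ^ 2) (gaussianReal 0 1) :=
    (memLp_id_gaussianReal (μ := 0) (v := 1) 2).integrable_sq
  have hvar : ∫ z, z ^ 2 ∂(gaussianReal 0 1) = 1 := by
    have h := variance_fun_id_gaussianReal (μ := 0) (v := 1)
    rw [variance_eq_integral (by fun_prop)] at h
    simpa using h
  calc ∫ z, |z| ∂(gaussianReal 0 1) ≤ ∫ z, (1 + z ^ 2) / 2 ∂(gaussianReal 0 1) :=
        integral_mono integrable_id_gaussianReal_std.abs
          (((integrable_const 1).add hsq).div_const 2) fun z => by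
            simp only; nlinarith [sq_nonneg (|z| - 1), sq_abs z]
    _ = 1 := by
      rw [integral_div, integral_add (integrable_const 1) hsq, hvar]; simp

/-! ### The normal quantile -/

theorem le_Phi_PhiInv {δ : ℝ} (h0 : 0 < δ) (h1 : δ < 1) : δ ≤ Phi (PhiInv δ) := by
  have hne : {x : ℝ | δ ≤ Phi x}.Nonempty := by
    obtain ⟨x, hx⟩ := ((tendsto_cdf_atTop (gaussianReal 0 1)).eventually (lt_mem_nhds h1)).exists
    exact ⟨x, hx.le⟩
  have hbdd : BddBelow {x : ℝ | δ ≤ Phi x} := by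
    obtain ⟨y, hy⟩ := ((tendsto_cdf_atBot (gaussianReal 0 1)).eventually (gt_mem_nhds h0)).exists
    refine ⟨y, fun x hx => ?_⟩
    by_contra! hlt
    exact absurd (hx.trans (monotone_cdf _ hlt.le)) (not_le.2 hy)
  have hcont : ContinuousWithinAt Phi (Set.Ici (PhiInv δ)) (PhiInv δ) :=
    (cdf (gaussianReal 0 1)).right_continuous _
  refine ge_of_tendsto (hcont.mono Set.Ioi_subset_Ici_self) ?_
  filter_upwards [self_mem_nhdsWithin] with x hx
  obtain ⟨y, hy, hyx⟩ := exists_lt_of_csInf_lt hne (Set.mem_Ioi.1 hx)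
  exact (Set.mem_ofPred.1 hy).trans (monotone_cdf _ hyx.le)

/-- Selection above the `δ`-quantile has probability at most `1 - δ`, so does selection above
any larger threshold. -/
theorem gaussianTail_le_one_sub {δ q : ℝ} (h0 : 0 < δ) (h1 : δ < 1) (hq : PhiInv δ ≤ q) :
    gaussianTail q ≤ 1 - δ := by
  refine (gaussianTail_anti hq).trans ?_
  have h : δ ≤ (gaussianReal 0 1).real (Set.Iic (PhiInv δ)) := by
    rw [← cdf_eq_real]; exact le_Phi_PhiInv h0 h1
  have h2 : (gaussianReal 0 1).real (Set.Iic (PhiInv δ)) ≤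
      (gaussianReal 0 1).real (Set.Iio (PhiInv δ)) + (gaussianReal 0 1).real {PhiInv δ} := by
    rw [← Set.Iio_union_right]; exact measureReal_union_le _ _
  rw [gaussianReal_std_noAtoms] at h2
  have h3 : gaussianTail (PhiInv δ) = 1 - (gaussianReal 0 1).real (Set.Iio (PhiInv δ)) := by
    rw [gaussianTail, ← Set.compl_Iio, probReal_compl_eq_one_sub measurableSet_Iio]
  linarith

/-! ### Asymptotics of the cut-offs -/

/-- The common form of the cut-offs of the construction: for large `x`, the upper tail of the
standard normal law at this point is `(1 + o(1)) β / (k x)`. -/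
noncomputable def tailCut (k x β : ℝ) : ℝ := √(2 * Real.log (k * x / (β * Cc x β)))

/-- The constant term in the expansion of `tailCut k x β ^ 2` in terms of `log (x / β)`. -/
noncomputable def cutConst (k : ℝ) : ℝ := 2 * Real.log (k / (2 * √Real.pi))

theorem tailCut_nonneg (k x β : ℝ) : 0 ≤ tailCut k x β := Real.sqrt_nonneg _

theorem two_mul_log_cut {k x β : ℝ} (hk : 0 < k) (hβ : 0 < β) (hx : β < x) :
    2 * Real.log (k * x / (β * Cc x β)) =
      2 * Real.log (x / β) + cutConst k - Real.log (Real.log (x / β)) := by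
  have hL : 0 < Real.log (x / β) := Real.log_pos ((one_lt_div hβ).2 hx)
  have hx0 : 0 < x := hβ.trans hx
  have hpi : 0 < √Real.pi := Real.sqrt_pos.2 Real.pi_pos
  have hsL : 0 < √(Real.log (x / β)) := Real.sqrt_pos.2 hL
  have h : k * x / (β * Cc x β) =
      x / β * (k / (2 * √Real.pi)) / √(Real.log (x / β)) := by
    rw [Cc, Real.sqrt_mul Real.pi_pos.le]
    field_simp
  rw [h, Real.log_div (by positivity) hsL.ne', Real.log_mul (by positivity) (by positivity),
    Real.log_sqrt hL.le, cutConst]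
  ring

theorem tailCut_eq {k x β : ℝ} (hk : 0 < k) (hβ : 0 < β) (hx : β < x) :
    tailCut k x β = √(2 * Real.log (x / β) + cutConst k - Real.log (Real.log (x / β))) := by
  rw [tailCut, two_mul_log_cut hk hβ hx]

theorem tendsto_log_div_atTop {β : ℝ} (hβ : 0 < β) :
    Tendsto (fun x : ℝ => Real.log (x / β)) atTop atTop :=
  Real.tendsto_log_atTop.comp (tendsto_id.atTop_div_const hβ)

theorem eventually_tailCut_le {k β : ℝ} (hk : 0 < k) (hβ : 0 < β) :
    ∀ᶠ x in atTop, tailCut k x β ≤ √(2 * Real.log (x / β)) := by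
  filter_upwards [eventually_gt_atTop β, (Real.tendsto_log_atTop.comp
    (tendsto_log_div_atTop hβ)).eventually_ge_atTop (cutConst k)] with x hx hc
  rw [tailCut_eq hk hβ hx]
  apply Real.sqrt_le_sqrt
  simp only [Function.comp_apply] at hc
  linarith

theorem tendsto_log_add_const_div (c : ℝ) :
    Tendsto (fun y : ℝ => (c - Real.log y) / y) atTop (𝓝 0) := by
  have h1 : Tendsto (fun y : ℝ => Real.log y / y) atTop (𝓝 0) :=
    Real.isLittleO_log_id_atTop.tendsto_div_nhds_zero
  have h2 : Tendsto (fun y : ℝ => c / y) atTop (𝓝 0) := tendsto_const_nhds.div_atTop tendsto_id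
  simpa [sub_div] using h2.sub h1

theorem eventually_sqrt_log_le_tailCut {k β : ℝ} (hk : 0 < k) (hβ : 0 < β) :
    ∀ᶠ x in atTop, √(Real.log (x / β)) ≤ tailCut k x β := by
  have h := (tendsto_log_div_atTop hβ).eventually
    ((tendsto_log_add_const_div (cutConst k)).eventually
      (lt_mem_nhds (show (-1 : ℝ) < 0 by norm_num)))
  filter_upwards [eventually_gt_atTop β, h] with x hx hc
  have hL : 0 < Real.log (x / β) := Real.log_pos ((one_lt_div hβ).2 hx)
  rw [tailCut_eq hk hβ hx]
  apply Real.sqrt_le_sqrt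
  rw [lt_div_iff₀ hL] at hc
  linarith

theorem tendsto_tailCut {k β : ℝ} (hk : 0 < k) (hβ : 0 < β) :
    Tendsto (fun x => tailCut k x β) atTop atTop :=
  tendsto_atTop_mono' atTop (eventually_sqrt_log_le_tailCut hk hβ)
    (Real.tendsto_sqrt_atTop.comp (tendsto_log_div_atTop hβ))

/-- Mills' bound at a cut-off: the constant `C_{x,β}` is chosen such that `x` times the tail
probability is asymptotically `β / k`. -/
theorem eventually_mul_gaussianTail_le {k β : ℝ} (hk : 0 < k) (hβ : 0 < β) {ε : ℝ} (hε : 0 < ε) :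
    ∀ᶠ x in atTop, x * gaussianTail (tailCut k x β) ≤ β / k + ε := by
  have hlim : Tendsto (fun y : ℝ => β / k * (√(1 + (cutConst k - Real.log y) / y / 2))⁻¹) atTop
      (𝓝 (β / k * (√(1 + 0 / 2))⁻¹)) := by
    refine Tendsto.const_mul _ (Tendsto.inv₀ ?_ (by simp))
    exact (((tendsto_log_add_const_div _).div_const 2).const_add 1).sqrt
  have h0 : β / k * (√(1 + 0 / 2))⁻¹ < β / k + ε := by simpa using hε
  filter_upwards [eventually_gt_atTop β,
    (tendsto_tailCut hk hβ).eventually_gt_atTop 0,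
    (tendsto_log_div_atTop hβ).eventually (hlim.eventually (gt_mem_nhds h0))] with x hx hu hy
  have hL : 0 < Real.log (x / β) := Real.log_pos ((one_lt_div hβ).2 hx)
  have hx0 : 0 < x := hβ.trans hx
  have hC : 0 < Cc x β := by
    unfold Cc
    have := Real.pi_pos
    positivity
  set y := Real.log (x / β) with hydef
  refine le_trans ?_ hy.le
  have hlogpos : 0 < 2 * Real.log (k * x / (β * Cc x β)) := Real.sqrt_pos.1 hu
  have hexp : Real.exp (-tailCut k x β ^ 2 / 2) = β * Cc x β / (k * x) := by
    have : -tailCut k x β ^ 2 / 2 = -Real.log (k * x / (β * Cc x β)) := by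
      rw [tailCut, Real.sq_sqrt hlogpos.le]; ring
    rw [this, Real.exp_neg, Real.exp_log (by positivity), inv_div]
  have hcut : tailCut k x β = √(2 * y) * √(1 + (cutConst k - Real.log y) / y / 2) := by
    rw [tailCut_eq hk hβ hx, ← hydef, ← Real.sqrt_mul (by positivity)]
    congr 1
    field_simp
    ring
  have hroot : 0 < √(1 + (cutConst k - Real.log y) / y / 2) := by
    rw [hcut] at hu
    exact pos_of_mul_pos_right hu (Real.sqrt_nonneg _)
  calc x * gaussianTail (tailCut k x β)
      ≤ x * (Real.exp (-tailCut k x β ^ 2 / 2) / (tailCut k x β * √(2 * Real.pi))) :=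
        mul_le_mul_of_nonneg_left (gaussianTail_le hu) hx0.le
    _ = β / k * (√(1 + (cutConst k - Real.log y) / y / 2))⁻¹ := by
        rw [hexp, hcut, Cc, Real.sqrt_mul Real.pi_pos.le, Real.sqrt_mul zero_le_two,
          Real.sqrt_mul zero_le_two, ← hydef]
        have h3 : 0 < √2 := Real.sqrt_pos.2 two_pos
        have h4 : 0 < √y := Real.sqrt_pos.2 hL
        have h5 : 0 < √Real.pi := Real.sqrt_pos.2 Real.pi_pos
        field_simp
        rw [Real.sq_sqrt zero_le_two]

/-- A lower bound for `tailCut 2` valid for all `x ≥ 1`; it is positive because `π < 2 e`. -/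
noncomputable def minCut : ℝ := √(1 + Real.log 2 - Real.log Real.pi)

theorem minCut_pos : 0 < minCut := by
  apply Real.sqrt_pos.2
  have h : Real.log Real.pi < Real.log (2 * Real.exp 1) :=
    Real.log_lt_log Real.pi_pos (by linarith [Real.pi_lt_d2, Real.exp_one_gt_d9])
  rw [Real.log_mul two_ne_zero (Real.exp_pos 1).ne', Real.log_exp] at h
  linarith

theorem minCut_le_tailCut {x β : ℝ} (hβ : 0 < β) (hβ1 : β < 1) (hx : 1 ≤ x) :
    minCut ≤ tailCut 2 x β := by
  have hx' : β < x := hβ1.trans_le hx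
  have hL : 0 < Real.log (x / β) := Real.log_pos ((one_lt_div hβ).2 hx')
  rw [tailCut_eq two_pos hβ hx', minCut]
  apply Real.sqrt_le_sqrt
  have h1 := Real.log_le_sub_one_of_pos (show 0 < 2 * Real.log (x / β) by positivity)
  rw [Real.log_mul two_ne_zero hL.ne'] at h1
  have h2 : cutConst 2 = -Real.log Real.pi := by
    rw [cutConst, div_mul_eq_div_div, div_self two_ne_zero, one_div, Real.log_inv,
      Real.log_sqrt Real.pi_pos.le]
    ring
  linarith

/-- The cut-off `tailCut 1 x β` falls short of `√(2 log (2 x))` by less than any constant. -/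
theorem eventually_sqrt_lt_tailCut_add {β : ℝ} (hβ : 0 < β) {c : ℝ} (hc : 0 < c) :
    ∀ᶠ x in atTop, √(2 * Real.log (2 * x)) < tailCut 1 x β + c := by
  have h : Tendsto (fun y : ℝ => (2 * Real.log (2 * β) - cutConst 1 + Real.log y) / y ^ (1 / 2 : ℝ))
      atTop (𝓝 0) := by
    have h1 : Tendsto (fun y : ℝ => Real.log y / y ^ (1 / 2 : ℝ)) atTop (𝓝 0) :=
      (isLittleO_log_rpow_atTop (by norm_num)).tendsto_div_nhds_zero
    have h2 : Tendsto (fun y : ℝ => (2 * Real.log (2 * β) - cutConst 1) / y ^ (1 / 2 : ℝ)) atTop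
        (𝓝 0) := tendsto_const_nhds.div_atTop (tendsto_rpow_atTop (by norm_num))
    simpa [add_div] using h2.add h1
  filter_upwards [eventually_gt_atTop β, eventually_sqrt_log_le_tailCut one_pos hβ,
    (tendsto_tailCut one_pos hβ).eventually_gt_atTop 0,
    (tendsto_log_div_atTop hβ).eventually
      (h.eventually (gt_mem_nhds (show 0 < 2 * c by positivity)))] with x hx hlow hu hlog
  have hL : 0 < Real.log (x / β) := Real.log_pos ((one_lt_div hβ).2 hx)
  rw [← Real.sqrt_eq_rpow, div_lt_iff₀ (Real.sqrt_pos.2 hL)] at hlog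
  rw [Real.sqrt_lt' (by positivity)]
  have hsq : tailCut 1 x β ^ 2 =
      2 * Real.log (x / β) + cutConst 1 - Real.log (Real.log (x / β)) := by
    have := hu
    rw [tailCut_eq one_pos hβ hx] at this ⊢
    exact Real.sq_sqrt (Real.sqrt_pos.1 this).le
  have h2x : Real.log (2 * x) = Real.log (x / β) + Real.log (2 * β) := by
    have := hβ.trans hx
    rw [← Real.log_mul (by positivity) (by positivity)]
    congr 1
    field_simp
  rw [h2x]
  nlinarith [mul_le_mul_of_nonneg_left hlow hc.le, sq_nonneg c]

/-- The high signal-to-noise cut-off dominates `tailCut` once its constant is large. -/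
theorem tailCut_le_sqrt {k x β C : ℝ} (hk : 0 < k) (hβ : 0 < β) (hβ1 : β < 1) (hx : 1 < x)
    (hC : cutConst k - 2 * Real.log β ≤ C) :
    tailCut k x β ≤ √(2 * Real.log x - Real.log (Real.log x) + C) := by
  rw [tailCut_eq hk hβ (hβ1.trans hx)]
  apply Real.sqrt_le_sqrt
  have hlogx : 0 < Real.log x := Real.log_pos hx
  have hlogβ : Real.log β < 0 := Real.log_neg hβ hβ1
  rw [Real.log_div (by linarith) hβ.ne']
  have := Real.log_le_log hlogx (show Real.log x ≤ Real.log x - Real.log β by linarith)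
  linarith

theorem highThreshold_eq (d s : ℕ) (α α' : ℝ) :
    highThreshold d s α α' = tailCut 2 ((d : ℝ) - s) (α - α') := rfl

theorem kappaStarStar_eq (s : ℕ) (δ α' : ℝ) :
    kappaStarStar s δ α' = PhiInv δ + tailCut 1 s α' := by
  rw [kappaStarStar, tailCut, one_mul, mul_comm α']

theorem kappaBar_eq (d s : ℕ) (α α' : ℝ) :
    kappaBar d s α α' = tailCut 2 ((d : ℝ) - s) (α - α') + tailCut 1 s α' := by
  rw [kappaBar, highThreshold_eq, tailCut, tailCut, one_mul, mul_comm α']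

theorem uBar_low {d s : ℕ} {a σ α α' : ℝ} (h : a / σ < kappaBar d s α α') :
    uBar d s a σ α α' = tailCut 1 d (α - α') := by
  rw [uBar, if_pos h, tailCut, one_mul]

theorem uBar_high {d s : ℕ} {a σ α α' : ℝ} (h : kappaBar d s α α' ≤ a / σ) :
    uBar d s a σ α α' = tailCut 2 s (α - α') := by
  rw [uBar, if_neg (not_lt.2 h), tailCut]

theorem selThreshold_low {d s : ℕ} {a σ α α' δ : ℝ} (h : a / σ < kappaBar d s α α') :
    selThreshold d s a σ α α' δ = PhiInv δ := by
  rw [selThreshold, if_pos h]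

theorem selThreshold_high {d s : ℕ} {a σ α α' δ : ℝ} (h : kappaBar d s α α' ≤ a / σ) :
    selThreshold d s a σ α α' δ = tailCut 2 ((d : ℝ) - s) (α - α') := by
  rw [selThreshold, if_neg (not_lt.2 h), highThreshold_eq]

theorem uBar_nonneg (d s : ℕ) (a σ α α' : ℝ) : 0 ≤ uBar d s a σ α α' := by
  rw [uBar]
  split_ifs <;> exact Real.sqrt_nonneg _

/-! ### Marginals of the observation -/

section LowerBound

variable {d : ℕ}

theorem normalMean_eq_pi (σ : ℝ) (θ : Fin d → ℝ) :
    normalMean σ θ = Measure.pi fun j => gaussianReal (θ j) (.mk (σ ^ 2) (sq_nonneg σ)) := rfl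

instance isProbabilityMeasure_normalMean (σ : ℝ) (θ : Fin d → ℝ) :
    IsProbabilityMeasure (normalMean σ θ) := by
  rw [normalMean_eq_pi]; infer_instance

theorem gaussianReal_eq_map_std (θ σ : ℝ) :
    gaussianReal θ (.mk (σ ^ 2) (sq_nonneg σ)) = (gaussianReal 0 1).map (fun z => θ + σ * z) := by
  have h : (fun z : ℝ => θ + σ * z) = (fun z => θ + z) ∘ fun z => σ * z := rfl
  rw [h, ← Measure.map_map (by fun_prop) (by fun_prop), gaussianReal_map_const_mul,
    gaussianReal_map_const_add]
  simp

theorem normalMean_map_eval (σ : ℝ) (θ : Fin d → ℝ) (j : Fin d) :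
    (normalMean σ θ).map (fun x => x j) = (gaussianReal 0 1).map (fun z => θ j + σ * z) := by
  rw [← gaussianReal_eq_map_std]
  exact (measurePreserving_eval (fun j => gaussianReal (θ j) (.mk (σ ^ 2) (sq_nonneg σ))) j).map_eq

theorem normalMean_real_eval (σ : ℝ) (θ : Fin d → ℝ) (j : Fin d) {B : Set ℝ}
    (hB : MeasurableSet B) :
    (normalMean σ θ).real {x | x j ∈ B} = (gaussianReal 0 1).real {z | θ j + σ * z ∈ B} := by
  have h1 := map_measureReal_apply (μ := normalMean σ θ) (measurable_pi_apply j) hB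
  have h2 := map_measureReal_apply (μ := gaussianReal 0 1) (f := fun z => θ j + σ * z)
    (by fun_prop) hB
  rw [normalMean_map_eval, h2] at h1
  exact h1.symm

theorem integral_normalMean_eval (σ : ℝ) (θ : Fin d → ℝ) (j : Fin d) {f : ℝ → ℝ}
    (hf : Measurable f) :
    ∫ x, f (x j) ∂(normalMean σ θ) = ∫ z, f (θ j + σ * z) ∂(gaussianReal 0 1) := by
  rw [← integral_map (φ := fun x : Fin d → ℝ => x j) (measurable_pi_apply j).aemeasurable
      hf.aestronglyMeasurable,
    normalMean_map_eval, integral_map (by fun_prop) hf.aestronglyMeasurable]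

/-! ### The lower bound on the risk -/

namespace SparseConfSet

/-- The lower bound of coordinate `j` as a function of the single observation `X_j`. -/
def lower (M : SparseConfSet d) (j : Fin d) (y : ℝ) : ℝ := M.L (fun _ => y) j

theorem measurable_lower (M : SparseConfSet d) (j : Fin d) : Measurable (M.lower j) :=
  (M.measurable_L j).comp (by fun_prop : Measurable fun (y : ℝ) (_ : Fin d) => y)

variable {M : SparseConfSet d}

theorem IsOneSided.L_eq (hM : M.IsOneSided) (x : Fin d → ℝ) (j : Fin d) :
    M.L x j = M.lower j (x j) :=
  (hM.1 j x (fun _ => x j) rfl).1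

theorem IsOneSided.lower_mem (hM : M.IsOneSided) (j : Fin d) (y : ℝ) :
    0 ≤ M.lower j y ∧ M.lower j y ≤ max y 0 := by
  by_cases h : j ∈ M.S fun _ => y
  · exact ⟨(hM.2.1 _ j h).1, (hM.2.1 _ j h).2.1⟩
  · rw [lower, (hM.2.2 _ j h).1]
    exact ⟨le_rfl, le_max_right _ _⟩

theorem IsOneSided.lower_le_of_mem_region (hM : M.IsOneSided) {θ x : Fin d → ℝ}
    (hx : θ ∈ M.region x) {j : Fin d} (hj : 0 ≤ θ j) : M.lower j (x j) ≤ θ j := by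
  rw [← hM.L_eq]
  by_cases h : j ∈ M.S x
  · exact (hx.2 j h).1
  · rwa [(hM.2.2 x j h).1]

theorem IsOneSided.integral_eq (hM : M.IsOneSided) (σ : ℝ) (θ : Fin d → ℝ) (j : Fin d) :
    ∫ x, (θ j - M.L x j) ∂(normalMean σ θ) =
      ∫ z, (θ j - M.lower j (θ j + σ * z)) ∂(gaussianReal 0 1) := by
  simp_rw [hM.L_eq]
  exact integral_normalMean_eval σ θ j (f := fun y => θ j - M.lower j y)
    ((M.measurable_lower j).const_sub _)

theorem IsOneSided.integrable_lower (hM : M.IsOneSided) (j : Fin d) (b σ : ℝ) :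
    Integrable (fun z => M.lower j (b + σ * z)) (gaussianReal 0 1) := by
  refine Integrable.mono' (g := fun z => |b + σ * z|)
    ((integrable_const b).add (integrable_id_gaussianReal_std.const_mul σ)).abs
    ((M.measurable_lower j).comp (by fun_prop)).aestronglyMeasurable (ae_of_all _ fun z => ?_)
  have h := hM.lower_mem j (b + σ * z)
  rw [Real.norm_of_nonneg h.1]
  exact h.2.trans (max_le (le_abs_self _) (abs_nonneg _))

theorem le_risk (M : SparseConfSet d) {s : ℕ} {a σ : ℝ} (j : Fin d) {θ : Fin d → ℝ}
    (hθ : θ ∈ ThetaPlus d s a) :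
    ((∫ x, (θ j - M.L x j) ∂(normalMean σ θ) : ℝ) : EReal) ≤ M.risk s a σ :=
  le_iSup_of_le (f := fun j : Fin d => ⨆ θ ∈ ThetaPlus d s a,
    ((∫ x, (θ j - M.L x j) ∂(normalMean σ θ) : ℝ) : EReal)) j
    (le_iSup₂_of_le (f := fun θ (_ : θ ∈ ThetaPlus d s a) =>
      ((∫ x, (θ j - M.L x j) ∂(normalMean σ θ) : ℝ) : EReal)) θ hθ le_rfl)

/-- Coverage of the vector that equals `b` on `J` and vanishes elsewhere is a product of marginal
probabilities. If it is bounded away from zero, then for some `j ∈ J` the bound `L_j` exceeds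
`b` with probability at most of order `1 / #J`. -/
theorem IsOneSided.exists_overshoot_le (hM : M.IsOneSided) {s : ℕ} {a σ b K : ℝ} (hb : 0 ≤ b)
    {J : Finset (Fin d)} (hJ : J.Nonempty)
    (hθ : (fun j => if j ∈ J then b else 0) ∈ ThetaPlus d s a)
    (hcov : ENNReal.ofReal (Real.exp (-K)) < M.coverage s a σ) :
    ∃ j ∈ J, (gaussianReal 0 1).real {z | b < M.lower j (b + σ * z)} ≤ K / J.card := by
  by_contra! hcon
  refine absurd hcov (not_lt.2 ?_)
  set θ : Fin d → ℝ := fun j => if j ∈ J then b else 0 with hθdef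
  have hθ0 : ∀ j, 0 ≤ θ j := fun j => by
    rw [hθdef]; dsimp only; split_ifs; exacts [hb, le_rfl]
  have hcard : (0 : ℝ) < J.card := by exact_mod_cast hJ.card_pos
  have hmeas : ∀ j, MeasurableSet {y | M.lower j y ≤ θ j} := fun j =>
    measurableSet_le (M.measurable_lower j) measurable_const
  have hone : ∀ j ∈ J, gaussianReal (θ j) (.mk (σ ^ 2) (sq_nonneg σ)) {y | M.lower j y ≤ θ j} ≤
      ENNReal.ofReal (Real.exp (-(K / J.card))) := by
    intro j hj
    have hθj : θ j = b := if_pos hj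
    rw [hθj, gaussianReal_eq_map_std, Measure.map_apply (by fun_prop) (hθj ▸ hmeas j),
      ← ofReal_measureReal]
    apply ENNReal.ofReal_le_ofReal
    have hc : (fun z => b + σ * z) ⁻¹' {y | M.lower j y ≤ b} =
        {z | b < M.lower j (b + σ * z)}ᶜ := by
      ext z; simp
    have hm : MeasurableSet {z | b < M.lower j (b + σ * z)} :=
      measurableSet_lt measurable_const ((M.measurable_lower j).comp (by fun_prop))
    rw [hc, probReal_compl_eq_one_sub hm]
    have h1 := Real.add_one_le_exp (-(K / J.card))
    linarith [hcon j hj]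
  calc M.coverage s a σ ≤ normalMean σ θ {x | θ ∈ M.region x} := iInf₂_le θ hθ
    _ ≤ normalMean σ θ (Set.univ.pi fun j => {y | M.lower j y ≤ θ j}) :=
        measure_mono fun x hx j _ => hM.lower_le_of_mem_region hx (hθ0 j)
    _ = ∏ j, gaussianReal (θ j) (.mk (σ ^ 2) (sq_nonneg σ)) {y | M.lower j y ≤ θ j} :=
        by rw [normalMean_eq_pi]; exact Measure.pi_pi _ _
    _ ≤ ∏ j ∈ J, gaussianReal (θ j) (.mk (σ ^ 2) (sq_nonneg σ)) {y | M.lower j y ≤ θ j} :=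
        Finset.prod_le_prod_of_subset_of_le_one' (Finset.subset_univ J) fun j _ _ => prob_le_one
    _ ≤ ∏ _j ∈ J, ENNReal.ofReal (Real.exp (-(K / J.card))) := Finset.prod_le_prod' hone
    _ = ENNReal.ofReal (Real.exp (-K)) := by
        rw [Finset.prod_const, ← ENNReal.ofReal_pow (Real.exp_nonneg _), ← Real.exp_nat_mul]
        congr 2
        field_simp

/-- The lower bound on the risk. If the lower bound of coordinate `j` exceeds `b` with
probability at most `K / m` at mean `b`, then it exceeds `b` with probability at most about `1 / 2`
at mean `b + σ τ`, `τ = √(2 log m)`. There the error is at least about `σ τ` on the complementary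
event, and never falls below `-σ |Z|`. -/
theorem IsOneSided.le_risk_of_coverage (hM : M.IsOneSided) {s : ℕ} {a σ b K η : ℝ} (hσ : 0 < σ)
    (hb : 0 ≤ b) (hη : 0 ≤ η) (hs : 1 ≤ s) {J : Finset (Fin d)} (hJ : J.Nonempty)
    (hθ : (fun j => if j ∈ J then b else 0) ∈ ThetaPlus d s a)
    (ha : a ≤ b + σ * √(2 * Real.log J.card))
    (hcov : ENNReal.ofReal (Real.exp (-K)) < M.coverage s a σ) :
    ((σ * (√(2 * Real.log J.card) * (1 / 2 - η - K * Real.exp (-(η * √(2 * Real.log J.card))))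
      - 1) : ℝ) : EReal) ≤ M.risk s a σ := by
  obtain ⟨j, -, hj⟩ := hM.exists_overshoot_le hb hJ hθ hcov
  have hcard : (1 : ℝ) ≤ J.card := by exact_mod_cast hJ.card_pos
  set τ := √(2 * Real.log J.card) with hτ
  have hτ0 : 0 ≤ τ := Real.sqrt_nonneg _
  have hspike : (Pi.single j (b + σ * τ) : Fin d → ℝ) ∈ ThetaPlus d s a := by
    refine ⟨?_, fun i hi => ?_⟩
    · refine (Set.ncard_le_ncard (t := {j}) (fun i hi => ?_)).trans (by simpa using hs)
      by_contra h
      exact hi (Pi.single_eq_of_ne h _)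
    · rcases eq_or_ne i j with rfl | h
      · rwa [Pi.single_eq_same]
      · exact absurd (Pi.single_eq_of_ne h _) hi
  refine le_trans (EReal.coe_le_coe_iff.2 ?_) (M.le_risk j hspike)
  rw [hM.integral_eq, Pi.single_eq_same]
  set B : Set ℝ := {z | b < M.lower j (b + σ * z)} with hB
  have hBm : MeasurableSet B :=
    measurableSet_lt measurable_const ((M.measurable_lower j).comp (by fun_prop))
  have hEm : MeasurableSet {z | z + τ ∈ B} := (measurable_add_const τ) hBm
  have hshift := gaussianReal_shift_le hBm hτ0 hη
  have hexp : Real.exp (τ ^ 2 / 2 - η * τ) * (gaussianReal 0 1).real B ≤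
      K * Real.exp (-(η * τ)) := by
    have h1 : Real.exp (τ ^ 2 / 2 - η * τ) = J.card * Real.exp (-(η * τ)) := by
      have hlog : 0 ≤ Real.log J.card := Real.log_nonneg hcard
      rw [sub_eq_add_neg, Real.exp_add, hτ, Real.sq_sqrt (by positivity),
        mul_div_cancel_left₀ _ two_ne_zero, Real.exp_log (by linarith)]
    rw [h1, mul_right_comm]
    rw [le_div_iff₀ (by linarith), mul_comm] at hj
    exact mul_le_mul_of_nonneg_right hj (Real.exp_nonneg _)
  have hpt : ∀ z, σ * τ - {z | z + τ ∈ B}.indicator (fun _ => σ * τ) z - σ * |z| ≤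
      b + σ * τ - M.lower j (b + σ * τ + σ * z) := by
    intro z
    have hz : b + σ * (z + τ) = b + σ * τ + σ * z := by ring
    have habs : 0 ≤ σ * |z| := by positivity
    by_cases hmem : z + τ ∈ B
    · rw [Set.indicator_of_mem (by exact hmem)]
      have h1 := (hM.lower_mem j (b + σ * τ + σ * z)).2
      have h2 : max (b + σ * τ + σ * z) 0 ≤ b + σ * τ + σ * |z| := by
        apply max_le
        · gcongr; exact le_abs_self z
        · positivity
      linarith
    · rw [Set.indicator_of_notMem (by exact hmem)]
      have h1 : M.lower j (b + σ * (z + τ)) ≤ b := not_lt.1 hmem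
      rw [hz] at h1
      linarith
  have hind : Integrable ({z | z + τ ∈ B}.indicator fun _ => σ * τ) (gaussianReal 0 1) :=
    (integrable_const _).indicator hEm
  have habs : Integrable (fun z : ℝ => σ * |z|) (gaussianReal 0 1) :=
    integrable_id_gaussianReal_std.abs.const_mul σ
  have hint := integral_mono (((integrable_const (σ * τ)).sub hind).sub habs)
    ((integrable_const (b + σ * τ)).sub (hM.integrable_lower j (b + σ * τ) σ)) hpt
  refine le_trans ?_ hint
  rw [integral_sub' ((integrable_const _).sub hind) habs, integral_sub' (integrable_const _) hind,
    integral_indicator_const _ hEm]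
  simp only [integral_const, integral_const_mul, probReal_univ, smul_eq_mul, one_mul]
  have h1 := mul_le_mul_of_nonneg_left (hshift.trans (add_le_add_right hexp _))
    (mul_nonneg hσ.le hτ0)
  have h2 := mul_le_mul_of_nonneg_left integral_abs_gaussianReal_std_le hσ.le
  linarith

end SparseConfSet

end LowerBound

/-! ### The asymptotic lower bound -/

theorem tendsto_sqrt_two_mul_log {m : ℕ → ℕ} (hm : Tendsto m atTop atTop) :
    Tendsto (fun n => √(2 * Real.log (m n))) atTop atTop :=
  Real.tendsto_sqrt_atTop.comp
    ((Real.tendsto_log_atTop.comp (tendsto_natCast_atTop_atTop.comp hm)).const_mul_atTop two_pos)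

theorem tendsto_lower_ratio (K : ℝ) :
    Tendsto (fun τ : ℝ => 1 - 2 * (√τ)⁻¹ - 2 * K * Real.exp (-√τ) - 2 * τ⁻¹) atTop (𝓝 1) := by
  have h1 : Tendsto (fun τ : ℝ => 2 * (√τ)⁻¹) atTop (𝓝 0) := by
    simpa using (tendsto_inv_atTop_zero.comp Real.tendsto_sqrt_atTop).const_mul 2
  have h2 : Tendsto (fun τ : ℝ => 2 * K * Real.exp (-√τ)) atTop (𝓝 0) := by
    simpa using
      (Real.tendsto_exp_neg_atTop_nhds_zero.comp Real.tendsto_sqrt_atTop).const_mul (2 * K)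
  have h3 : Tendsto (fun τ : ℝ => 2 * τ⁻¹) atTop (𝓝 0) := by
    simpa using tendsto_inv_atTop_zero.const_mul (2 : ℝ)
  simpa using ((tendsto_const_nhds.sub h1).sub h2).sub h3

/-- The asymptotic lower bound, uniform over the confidence sets with a given coverage. The `m`
coordinates in `J`, all with mean `b`, are those among which one has
`L_j > b` with probability of order `1 / m` only. -/
theorem one_le_liminf_iInf_risk {α δ : ℝ} (hα : α < 1) {d s m : ℕ → ℕ} {a σ : ℕ → ℝ}
    (hm : Tendsto m atTop atTop) (hs : Tendsto s atTop atTop) (hσ : ∀ n, 0 < σ n)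
    (hJ : ∀ᶠ n in atTop, ∃ (b : ℝ) (J : Finset (Fin (d n))), 0 ≤ b ∧ J.card = m n ∧
      (fun j => if j ∈ J then b else 0) ∈ ThetaPlus (d n) (s n) (a n) ∧
      a n ≤ b + σ n * √(2 * Real.log (m n)))
    {c : ℕ → ℝ≥0∞} (hc : ENNReal.ofReal (1 - α) ≤ liminf c atTop) :
    1 ≤ liminf (fun n => ⨅ M ∈ coverageClass (d n) (s n) (a n) (σ n) δ (c n),
      M.risk (s n) (a n) (σ n) / ((σ n * √(2 * Real.log (m n)) / 2 : ℝ) : EReal)) atTop := by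
  obtain ⟨K, hK⟩ : ∃ K, Real.exp (-K) < 1 - α :=
    ⟨-Real.log ((1 - α) / 2), by
      rw [neg_neg, Real.exp_log (by linarith)]; linarith⟩
  have hcK : ENNReal.ofReal (Real.exp (-K)) < liminf c atTop :=
    ((ENNReal.ofReal_lt_ofReal_iff (by linarith)).2 hK).trans_le hc
  have hlim : Tendsto (fun n => ((1 - 2 * (√(√(2 * Real.log (m n))))⁻¹ -
      2 * K * Real.exp (-√(√(2 * Real.log (m n)))) - 2 * (√(2 * Real.log (m n)))⁻¹ : ℝ) : EReal))
      atTop (𝓝 ((1 : ℝ) : EReal)) :=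
    (continuous_coe_real_ereal.tendsto 1).comp
      ((tendsto_lower_ratio K).comp (tendsto_sqrt_two_mul_log hm))
  rw [EReal.coe_one] at hlim
  rw [← hlim.liminf_eq]
  refine liminf_le_liminf ?_
  filter_upwards [eventually_lt_of_lt_liminf hcK, hJ, hs.eventually_ge_atTop 1,
    hm.eventually_ge_atTop 1, (tendsto_sqrt_two_mul_log hm).eventually_gt_atTop 0]
    with n hcn hJn hsn hmn hτ
  refine le_iInf₂ fun M hM => ?_
  obtain ⟨b, J, hb, hcard, hθ, ha⟩ := hJn
  have hJne : J.Nonempty := by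
    rw [← Finset.card_pos]; omega
  rw [← hcard] at ha hτ ⊢
  set τ := √(2 * Real.log J.card) with hτdef
  rw [EReal.le_div_iff_mul_le (by exact_mod_cast half_pos (mul_pos (hσ n) hτ))
    (EReal.coe_ne_top _), ← EReal.coe_mul]
  have hsq : 0 < √τ := Real.sqrt_pos.2 hτ
  refine le_trans (EReal.coe_le_coe_iff.2 (le_of_eq ?_))
    (hM.1.le_risk_of_coverage (η := (√τ)⁻¹) (hσ n) hb (inv_nonneg.2 hsq.le) hsn hJne hθ ha
      (hcn.trans_le hM.2.2))
  rw [← hτdef]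
  have h1 : (√τ)⁻¹ * τ = √τ := by
    nth_rewrite 2 [← Real.mul_self_sqrt hτ.le]
    field_simp
  rw [h1]
  field_simp

/-- A uniform lower bound over the classes `coverageClass` applies to each member of `MPlus`, with
its own coverage as the prescribed one. -/
theorem one_le_liminf_risk_of_MPlus {α δ : ℝ} {d s : ℕ → ℕ} {a σ r : ℕ → ℝ}
    (h : ∀ c : ℕ → ℝ≥0∞, ENNReal.ofReal (1 - α) ≤ liminf c atTop →
      1 ≤ liminf (fun n => ⨅ M ∈ coverageClass (d n) (s n) (a n) (σ n) δ (c n),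
        M.risk (s n) (a n) (σ n) / (r n : EReal)) atTop)
    {M : ∀ n, SparseConfSet (d n)} (hM : M ∈ MPlus d s a σ α δ) :
    1 ≤ liminf (fun n => (M n).risk (s n) (a n) (σ n) / (r n : EReal)) atTop := by
  refine (h _ hM.2).trans (liminf_le_liminf ?_)
  filter_upwards [hM.1] with n hn
  exact iInf₂_le (M n) ⟨hn.1, hn.2, le_rfl⟩

theorem zero_mem_ThetaPlus (d s : ℕ) (a : ℝ) : (fun _ => 0) ∈ ThetaPlus d s a := by
  simp [ThetaPlus]

theorem ite_mem_ThetaPlus {d s : ℕ} {a : ℝ} {J : Finset (Fin d)} (hJ : J.card ≤ s) :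
    (fun j => if j ∈ J then a else 0) ∈ ThetaPlus d s a := by
  have hsub : ∀ j, (if j ∈ J then a else 0) ≠ 0 → j ∈ J := fun j hj => by
    by_contra h
    exact hj (if_neg h)
  refine ⟨?_, fun j hj => ?_⟩
  · refine (Set.ncard_le_ncard (t := (J : Set (Fin d))) hsub (Finset.finite_toSet J)).trans ?_
    rwa [Set.ncard_coe_finset]
  · dsimp only
    rw [if_pos (hsub j hj)]

/-- Lower bound when the signal strength is at most `√(2 log d)`: all `d` coordinates have mean
zero. -/
theorem one_le_liminf_iInf_risk_moderate {α δ : ℝ} (hα : α < 1) {d s : ℕ → ℕ} {a σ : ℕ → ℝ}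
    (hd : Tendsto d atTop atTop) (hs : Tendsto s atTop atTop) (hσ : ∀ n, 0 < σ n)
    (ha : ∀ᶠ n in atTop, a n / σ n ≤ √(2 * Real.log (d n)))
    {c : ℕ → ℝ≥0∞} (hc : ENNReal.ofReal (1 - α) ≤ liminf c atTop) :
    1 ≤ liminf (fun n => ⨅ M ∈ coverageClass (d n) (s n) (a n) (σ n) δ (c n),
      M.risk (s n) (a n) (σ n) / ((σ n * √(2 * Real.log (d n)) / 2 : ℝ) : EReal)) atTop := by
  refine one_le_liminf_iInf_risk hα hd hs hσ ?_ hc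
  filter_upwards [ha] with n han
  refine ⟨0, Finset.univ, le_rfl, by simp,
    by simpa only [ite_self] using zero_mem_ThetaPlus _ _ _, ?_⟩
  rwa [zero_add, mul_comm, ← div_le_iff₀ (hσ n)]

/-- Lower bound in terms of the sparsity: `s` coordinates have the smallest admissible mean. -/
theorem one_le_liminf_iInf_risk_high {α δ : ℝ} (hα : α < 1) {d s : ℕ → ℕ} {a σ : ℕ → ℝ}
    (hs : Tendsto s atTop atTop) (hsd : ∀ n, s n ≤ d n) (ha : ∀ n, 0 < a n) (hσ : ∀ n, 0 < σ n)
    {c : ℕ → ℝ≥0∞} (hc : ENNReal.ofReal (1 - α) ≤ liminf c atTop) :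
    1 ≤ liminf (fun n => ⨅ M ∈ coverageClass (d n) (s n) (a n) (σ n) δ (c n),
      M.risk (s n) (a n) (σ n) / ((σ n * √(2 * Real.log (s n)) / 2 : ℝ) : EReal)) atTop := by
  refine one_le_liminf_iInf_risk hα hs hs hσ (Eventually.of_forall fun n => ?_) hc
  obtain ⟨J, -, hJ⟩ := Finset.exists_subset_card_eq
    (show s n ≤ (Finset.univ : Finset (Fin (d n))).card by simpa using hsd n)
  exact ⟨a n, J, (ha n).le, hJ, ite_mem_ThetaPlus hJ.le,
    le_add_of_nonneg_right (mul_nonneg (hσ n).le (Real.sqrt_nonneg _))⟩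

/-! ### Coverage and risk of the proposed set at fixed dimension -/

section MBar

variable {d s : ℕ} {a σ α α' δ : ℝ}

theorem isOneSided_MBar (hσ : 0 < σ) : (MBar d s a σ α α' δ).IsOneSided := by
  refine ⟨fun j x y h => ?_, fun x j hj => ?_, fun x j hj => ?_⟩
  · simp only [MBar, h, and_self]
  · have hj' : selThreshold d s a σ α α' δ ≤ x j / σ := hj
    simp only [MBar, if_pos hj', and_true]
    refine ⟨le_max_right _ _, max_le_max ?_ le_rfl⟩
    linarith [mul_nonneg (uBar_nonneg d s a σ α α') hσ.le]
  · have hj' : ¬ selThreshold d s a σ α α' δ ≤ x j / σ := hj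
    simp only [MBar, if_neg hj', and_self]

theorem selectsAt_MBar (hσ : 0 < σ) (hδ : 0 < δ) (hδ1 : δ < 1)
    (hq : PhiInv δ ≤ selThreshold d s a σ α α' δ) : (MBar d s a σ α α' δ).SelectsAt σ δ := by
  refine ⟨fun j x y h => ?_, fun j => ?_⟩
  · simp only [MBar, Set.mem_ofPred_eq, h]
  · have h := normalMean_real_eval σ (0 : Fin d → ℝ) j
      (B := {y | selThreshold d s a σ α α' δ ≤ y / σ})
      (measurableSet_le measurable_const (by fun_prop))
    have hset : {z : ℝ | (0 : Fin d → ℝ) j + σ * z ∈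
        {y | selThreshold d s a σ α α' δ ≤ y / σ}} =
        Set.Ici (selThreshold d s a σ α α' δ) := by
      ext z
      simp [mul_div_cancel_left₀ _ hσ.ne']
    rw [hset] at h
    exact h.trans_le (gaussianTail_le_one_sub hδ hδ1 hq)

/-- A signal of strength at least `a` is missed with probability at most the tail at
`a / σ - q`. -/
theorem gaussianReal_missed_le {b q : ℝ} (hσ : 0 < σ) (hb : a ≤ b) :
    (gaussianReal 0 1).real {z | (b + σ * z) / σ < q} ≤ gaussianTail (a / σ - q) := by
  rw [← gaussianReal_std_Iic]
  refine measureReal_mono fun z hz => ?_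
  have hz' : (b + σ * z) / σ < q := hz
  rw [add_div, mul_div_cancel_left₀ _ hσ.ne'] at hz'
  have : a / σ ≤ b / σ := by gcongr
  rw [Set.mem_Iic]
  linarith

/-- The event, in terms of `X_j`, that the proposed set fails to cover coordinate `j` of `θ`: a
nonzero coordinate is missed, or the lower bound of a selected coordinate is too large. -/
def failureSet (q u σ θ : ℝ) : Set ℝ :=
  {y | (θ ≠ 0 ∧ y / σ < q) ∨ (q ≤ y / σ ∧ θ < y - u * σ)}

theorem measurableSet_failureSet (q u σ θ : ℝ) : MeasurableSet (failureSet q u σ θ) := by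
  have h1 : MeasurableSet {y : ℝ | y / σ < q} := measurableSet_lt (by fun_prop) measurable_const
  have h2 : MeasurableSet {y : ℝ | q ≤ y / σ} := measurableSet_le measurable_const (by fun_prop)
  have h3 : MeasurableSet {y : ℝ | θ < y - u * σ} :=
    measurableSet_lt measurable_const (by fun_prop)
  exact ((MeasurableSet.const (θ ≠ 0)).inter h1).union (h2.inter h3)

theorem gaussianReal_failureSet_le {q u θ : ℝ} (hσ : 0 < σ) (hθ : a ≤ θ) :
    (gaussianReal 0 1).real {z | θ + σ * z ∈ failureSet q u σ θ} ≤
      gaussianTail (a / σ - q) + gaussianTail u := by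
  refine (measureReal_mono (s₂ := {z | (θ + σ * z) / σ < q} ∪ Set.Ici u) fun z hz => ?_).trans
    ((measureReal_union_le _ _).trans (add_le_add_left (gaussianReal_missed_le hσ hθ) _))
  rcases hz with h | h
  · exact Or.inl h.2
  · refine Or.inr (Set.mem_Ici.2 (le_of_mul_le_mul_left ?_ hσ))
    linarith [h.2]

theorem gaussianReal_failureSet_zero_le {q u : ℝ} (hσ : 0 < σ) :
    (gaussianReal 0 1).real {z | 0 + σ * z ∈ failureSet q u σ 0} ≤
      min (gaussianTail q) (gaussianTail u) := by
  have hsub : ∀ z, 0 + σ * z ∈ failureSet q u σ 0 → q ≤ z ∧ u ≤ z := by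
    intro z hz
    rcases hz with h | h
    · exact absurd rfl h.1
    · rw [zero_add, mul_div_cancel_left₀ _ hσ.ne'] at h
      refine ⟨h.1, le_of_mul_le_mul_left ?_ hσ⟩
      linarith [h.2]
  exact le_min (measureReal_mono fun z hz => (hsub z hz).1)
    (measureReal_mono fun z hz => (hsub z hz).2)

theorem mem_region_MBar {x θ : Fin d → ℝ} (hθ : ∀ j, 0 ≤ θ j)
    (h : ∀ j, x j ∉ failureSet (selThreshold d s a σ α α' δ) (uBar d s a σ α α') σ (θ j)) :
    θ ∈ (MBar d s a σ α α' δ).region x := by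
  refine ⟨fun j hj => ?_, fun j hj => ?_⟩
  · by_contra h0
    exact h j (Or.inl ⟨h0, not_le.1 hj⟩)
  · have hj' : selThreshold d s a σ α α' δ ≤ x j / σ := hj
    have hL : x j - uBar d s a σ α α' * σ ≤ θ j := by
      by_contra! h0
      exact h j (Or.inr ⟨hj', h0⟩)
    simp only [MBar, if_pos hj']
    exact ⟨max_le hL (hθ j), le_top⟩

/-- The union bound for the coverage. Coordinates equal to zero fail with probability at most the
tail at either `u` or the selection threshold `q`; the two alternatives for `ρ` correspond to the
use of the former for all of them, or of the latter for `d - s` of them. -/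
theorem le_coverage_MBar (hsd : s ≤ d) (ha : 0 < a) (hσ : 0 < σ) {ρ q u : ℝ}
    (hq : selThreshold d s a σ α α' δ = q) (hu : uBar d s a σ α α' = u)
    (hρ : s * gaussianTail (a / σ - q) + d * gaussianTail u ≤ ρ ∨
      s * gaussianTail (a / σ - q) + (s * gaussianTail u + ((d : ℝ) - s) * gaussianTail q) ≤ ρ) :
    ENNReal.ofReal (1 - ρ) ≤ (MBar d s a σ α α' δ).coverage s a σ := by
  refine le_iInf₂ fun θ hθ => ?_
  have hθ0 : ∀ j, 0 ≤ θ j := fun j => by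
    by_cases h : θ j = 0
    · exact h.ge
    · exact ha.le.trans (hθ.2 j h)
  rw [← ofReal_measureReal]
  apply ENNReal.ofReal_le_ofReal
  have hunion : 1 ≤ (normalMean σ θ).real {x | θ ∈ (MBar d s a σ α α' δ).region x} +
      ∑ j, (normalMean σ θ).real {x | x j ∈ failureSet q u σ (θ j)} := by
    rw [← probReal_univ (μ := normalMean σ θ)]
    refine (measureReal_mono (s₂ := {x | θ ∈ (MBar d s a σ α α' δ).region x} ∪
      ⋃ j, {x | x j ∈ failureSet q u σ (θ j)}) fun x _ => ?_).trans
      ((measureReal_union_le _ _).trans (add_le_add_right (measureReal_iUnion_fintype_le _) _))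
    by_cases h : ∃ j, x j ∈ failureSet q u σ (θ j)
    · exact Or.inr (Set.mem_iUnion.2 h)
    · push Not at h
      refine Or.inl (mem_region_MBar hθ0 ?_)
      rwa [hq, hu]
  set T := gaussianTail with hT
  have hterm : ∀ j, (normalMean σ θ).real {x | x j ∈ failureSet q u σ (θ j)} ≤
      if θ j ≠ 0 then T (a / σ - q) + T u else min (T q) (T u) := by
    intro j
    rw [normalMean_real_eval σ θ j (measurableSet_failureSet _ _ _ _)]
    split_ifs with h
    · exact gaussianReal_failureSet_le hσ (hθ.2 j h)
    · rw [not_not] at h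
      rw [h]
      exact gaussianReal_failureSet_zero_le hσ
  have hsum : ∑ j, (normalMean σ θ).real {x | x j ∈ failureSet q u σ (θ j)} ≤ ρ := by
    refine (Finset.sum_le_sum fun j _ => hterm j).trans ?_
    rw [Finset.sum_ite, Finset.sum_const, Finset.sum_const, nsmul_eq_mul, nsmul_eq_mul]
    have hk : (Finset.univ.filter fun j => θ j ≠ 0).card ≤ s := by
      have := hθ.1
      rwa [Set.ncard_eq_toFinset_card', Set.toFinset_ofPred] at this
    have hkd := Finset.card_filter_add_card_filter_not (s := Finset.univ) (fun j => θ j ≠ 0)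
    rw [Finset.card_univ, Fintype.card_fin] at hkd
    set k := (Finset.univ.filter fun j => θ j ≠ 0).card
    set l := (Finset.univ.filter fun j => ¬ θ j ≠ 0).card
    have hk' : (k : ℝ) ≤ s := by exact_mod_cast hk
    have hl : (l : ℝ) = d - k := by rw [← hkd]; push_cast; ring
    have hsd' : (s : ℝ) ≤ d := by exact_mod_cast hsd
    have hT0 : ∀ v, 0 ≤ T v := gaussianTail_nonneg
    have hmin1 := min_le_left (T q) (T u)
    have hmin2 := min_le_right (T q) (T u)
    have h1 := mul_le_mul_of_nonneg_right hk' (hT0 (a / σ - q))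
    rw [hl]
    rcases hρ with hρ | hρ
    · have h2 := mul_le_mul_of_nonneg_left hmin2 (by linarith : (0 : ℝ) ≤ d - k)
      linarith
    · have h2 := mul_le_mul_of_nonneg_left hmin2 (by linarith : (0 : ℝ) ≤ s - k)
      have h3 := mul_le_mul_of_nonneg_left hmin1 (by linarith : (0 : ℝ) ≤ d - s)
      linarith
  linarith

/-- The risk of the proposed set: a selected coordinate contributes at most `σ (u - Z)`, and a
missed one at most `σ (q - u)` more. -/
theorem risk_MBar_le (hσ : 0 < σ) {r q u : ℝ}
    (hq : selThreshold d s a σ α α' δ = q) (hu : uBar d s a σ α α' = u) (hr0 : 0 ≤ r)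
    (hr : max (q - u) 0 * gaussianTail (a / σ - q) ≤ r) :
    (MBar d s a σ α α' δ).risk s a σ ≤ ((σ * (u + r) : ℝ) : EReal) := by
  refine iSup_le fun j => iSup₂_le fun θ hθ => EReal.coe_le_coe_iff.2 ?_
  have hM : (MBar d s a σ α α' δ).IsOneSided := isOneSided_MBar hσ
  have hu0 : 0 ≤ u := hu ▸ uBar_nonneg d s a σ α α'
  rw [hM.integral_eq]
  by_cases h0 : θ j = 0
  · refine (integral_nonpos fun z => ?_).trans (mul_nonneg hσ.le (add_nonneg hu0 hr0))
    have := (hM.lower_mem j (θ j + σ * z)).1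
    simp only [Pi.zero_apply]
    linarith
  have hEm : MeasurableSet {z | (θ j + σ * z) / σ < q} :=
    measurableSet_lt (by fun_prop) measurable_const
  have hpt : ∀ z, θ j - (MBar d s a σ α α' δ).lower j (θ j + σ * z) ≤
      σ * u - σ * z + {z | (θ j + σ * z) / σ < q}.indicator (fun _ => σ * max (q - u) 0) z := by
    intro z
    by_cases hz : (θ j + σ * z) / σ < q
    · rw [Set.indicator_of_mem (by exact hz)]
      have h1 := (hM.lower_mem j (θ j + σ * z)).1
      rw [div_lt_iff₀ hσ] at hz
      have h2 := mul_le_mul_of_nonneg_left (le_max_left (q - u) 0) hσ.le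
      linarith
    · rw [Set.indicator_of_notMem (by exact hz)]
      have h1 : θ j + σ * z - u * σ ≤ (MBar d s a σ α α' δ).lower j (θ j + σ * z) := by
        simp only [SparseConfSet.lower, MBar, hq, hu, if_pos (not_lt.1 hz)]
        exact le_max_left _ _
      linarith
  have hind : Integrable ({z | (θ j + σ * z) / σ < q}.indicator fun _ => σ * max (q - u) 0)
      (gaussianReal 0 1) := (integrable_const _).indicator hEm
  have hlin : Integrable (fun z : ℝ => σ * z) (gaussianReal 0 1) :=
    integrable_id_gaussianReal_std.const_mul σ
  refine (integral_mono ((integrable_const _).sub (hM.integrable_lower j (θ j) σ))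
    (((integrable_const _).sub hlin).add hind) hpt).trans ?_
  rw [integral_add' ((integrable_const _).sub hlin) hind, integral_sub' (integrable_const _) hlin,
    integral_indicator_const _ hEm]
  have hmean : ∫ z, σ * z ∂(gaussianReal 0 1) = 0 :=
    (integral_const_mul σ _).trans (by rw [integral_id_gaussianReal, mul_zero])
  rw [hmean]
  simp only [integral_const, probReal_univ, smul_eq_mul, one_mul]
  have h1 := mul_le_mul_of_nonneg_left (gaussianReal_missed_le (q := q) hσ (hθ.2 j h0))
    (mul_nonneg hσ.le (le_max_right (q - u) 0))
  have h2 := mul_le_mul_of_nonneg_left hr hσ.le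
  linarith

end MBar

/-! ### Asymptotics of the proposed set -/

theorem tendsto_upper_ratio {β : ℝ} (hβ : 0 < β) (K : ℝ) {m : ℕ → ℕ}
    (hm : Tendsto m atTop atTop) :
    Tendsto (fun n => (√(2 * Real.log (m n / β)) + K) / √(2 * Real.log (m n))) atTop (𝓝 1) := by
  have hlog : Tendsto (fun n => Real.log (m n)) atTop atTop :=
    Real.tendsto_log_atTop.comp (tendsto_natCast_atTop_atTop.comp hm)
  have h1 : Tendsto (fun n => √(1 - Real.log β / Real.log (m n))) atTop (𝓝 1) := by
    simpa using ((tendsto_const_nhds (x := Real.log β)).div_atTop hlog).const_sub 1 |>.sqrt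
  have h2 : Tendsto (fun n => K / √(2 * Real.log (m n))) atTop (𝓝 0) :=
    tendsto_const_nhds.div_atTop (tendsto_sqrt_two_mul_log hm)
  have h3 := h1.add h2
  rw [add_zero] at h3
  refine h3.congr' ?_
  filter_upwards [hlog.eventually_gt_atTop 0, hm.eventually_gt_atTop 0] with n hn hmn
  have hmn' : (m n : ℝ) ≠ 0 := by exact_mod_cast hmn.ne'
  rw [add_div, ← Real.sqrt_div' _ (by positivity), Real.log_div hmn' hβ.ne']
  congr 2
  field_simp

theorem limsup_risk_le_one {d s m : ℕ → ℕ} {a σ : ℕ → ℝ} {β K : ℝ} (hβ : 0 < β)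
    (hm : Tendsto m atTop atTop) (hσ : ∀ n, 0 < σ n) {M : ∀ n, SparseConfSet (d n)}
    (h : ∀ᶠ n in atTop, (M n).risk (s n) (a n) (σ n) ≤
      ((σ n * (√(2 * Real.log (m n / β)) + K) : ℝ) : EReal)) :
    limsup (fun n => (M n).risk (s n) (a n) (σ n) /
      ((σ n * √(2 * Real.log (m n)) : ℝ) : EReal)) atTop ≤ 1 := by
  have hlim : Tendsto (fun n =>
      (((√(2 * Real.log (m n / β)) + K) / √(2 * Real.log (m n)) : ℝ) : EReal)) atTop
      (𝓝 ((1 : ℝ) : EReal)) :=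
    (continuous_coe_real_ereal.tendsto 1).comp (tendsto_upper_ratio hβ K hm)
  rw [EReal.coe_one] at hlim
  rw [← hlim.limsup_eq]
  refine limsup_le_limsup ?_
  filter_upwards [h, (tendsto_sqrt_two_mul_log hm).eventually_gt_atTop 0] with n hn hτ
  rw [EReal.div_le_iff_le_mul (by exact_mod_cast mul_pos (hσ n) hτ) (EReal.coe_ne_top _),
    ← EReal.coe_mul]
  refine hn.trans_eq ?_
  congr 1
  field_simp

section

variable {d s : ℕ → ℕ} {a σ : ℕ → ℝ} {α α' δ : ℝ}

/-- The proposed set belongs to `𝓜₊` as soon as the signal is above `κ**` in the first branch of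
the construction, and `d - s` is large in the second one. -/
theorem MBar_mem_MPlus (hα' : 0 < α') (hαα' : α' < α) (hδ : 0 < δ) (hδ1 : δ < 1)
    (hd : Tendsto d atTop atTop) (hs : Tendsto s atTop atTop) (hsd : ∀ n, s n ≤ d n)
    (ha : ∀ n, 0 < a n) (hσ : ∀ n, 0 < σ n)
    (hlow : ∀ᶠ n in atTop, a n / σ n < kappaBar (d n) (s n) α α' →
      kappaStarStar (s n) δ α' ≤ a n / σ n)
    (hhigh : ∀ D : ℝ, ∀ᶠ n in atTop, kappaBar (d n) (s n) α α' ≤ a n / σ n →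
      D ≤ (d n : ℝ) - s n) :
    (fun n => MBar (d n) (s n) (a n) (σ n) α α' δ) ∈ MPlus d s a σ α δ := by
  have hβ : 0 < α - α' := sub_pos.2 hαα'
  have hdR : Tendsto (fun n => (d n : ℝ)) atTop atTop := tendsto_natCast_atTop_atTop.comp hd
  have hsR : Tendsto (fun n => (s n : ℝ)) atTop atTop := tendsto_natCast_atTop_atTop.comp hs
  refine ⟨?_, ?_⟩
  · obtain ⟨D, hD⟩ := eventually_atTop.1
      ((tendsto_tailCut two_pos hβ).eventually_ge_atTop (PhiInv δ))
    filter_upwards [hhigh D] with n hn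
    refine ⟨isOneSided_MBar (hσ n), selectsAt_MBar (hσ n) hδ hδ1 ?_⟩
    rcases lt_or_ge (a n / σ n) (kappaBar (d n) (s n) α α') with h | h
    · rw [selThreshold_low h]
    · rw [selThreshold_high h]
      exact hD _ (hn h)
  have hcov : ∀ ε > 0, ∀ᶠ n in atTop, ENNReal.ofReal (1 - (α + ε)) ≤
      (MBar (d n) (s n) (a n) (σ n) α α' δ).coverage (s n) (a n) (σ n) := by
    intro ε hε
    have hε3 : 0 < ε / 3 := by positivity
    obtain ⟨D, hD⟩ := eventually_atTop.1 (eventually_mul_gaussianTail_le two_pos hβ hε3)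
    filter_upwards [hhigh D, hlow,
      hsR.eventually (eventually_mul_gaussianTail_le one_pos hα' hε3),
      hsR.eventually (eventually_mul_gaussianTail_le two_pos hβ hε3),
      hdR.eventually (eventually_mul_gaussianTail_le one_pos hβ hε3)] with n hn hln h1 h2 h3
    have hmissed : ∀ v, tailCut 1 (s n) α' ≤ v → s n * gaussianTail v ≤ α' / 1 + ε / 3 :=
      fun v hv => (mul_le_mul_of_nonneg_left (gaussianTail_anti hv) (Nat.cast_nonneg _)).trans h1
    rcases lt_or_ge (a n / σ n) (kappaBar (d n) (s n) α α') with h | h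
    · refine le_coverage_MBar (hsd n) (ha n) (hσ n) (selThreshold_low h) (uBar_low h) (Or.inl ?_)
      have h4 := hln h
      rw [kappaStarStar_eq] at h4
      have h5 := hmissed (a n / σ n - PhiInv δ) (by linarith)
      linarith
    · refine le_coverage_MBar (hsd n) (ha n) (hσ n) (selThreshold_high h) (uBar_high h)
        (Or.inr ?_)
      have h4 := h
      rw [kappaBar_eq] at h4
      have h5 := hmissed (a n / σ n - tailCut 2 ((d n : ℝ) - s n) (α - α')) (by linarith)
      have h6 := hD _ (hn h)
      linarith
  have hlim : Tendsto (fun ε : ℝ => ENNReal.ofReal (1 - (α + ε))) (𝓝[>] 0)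
      (𝓝 (ENNReal.ofReal (1 - α))) := by
    have hc : Continuous fun ε : ℝ => ENNReal.ofReal (1 - (α + ε)) :=
      ENNReal.continuous_ofReal.comp (by fun_prop)
    have := hc.tendsto 0
    rw [add_zero] at this
    exact this.mono_left nhdsWithin_le_nhds
  refine le_of_tendsto hlim ?_
  filter_upwards [self_mem_nhdsWithin] with ε hε
  exact le_liminf_of_le (by isBoundedDefault) (hcov ε hε)

/-- Below `√(2 log d)` the second branch of the construction occurs only if `s < d / 2`: for
`s ≥ d / 2` the cut-off `κ̄` exceeds `√(2 log (2 s)) ≥ √(2 log d)`. -/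
theorem eventually_le_sub_of_moderate (hα' : 0 < α') (hαα' : α' < α) (hα1 : α < 1)
    (hd : Tendsto d atTop atTop) (hs : Tendsto s atTop atTop)
    (ha : ∀ᶠ n in atTop, a n / σ n ≤ √(2 * Real.log (d n))) (hsd : ∀ᶠ n in atTop, s n < d n)
    (D : ℝ) :
    ∀ᶠ n in atTop, kappaBar (d n) (s n) α α' ≤ a n / σ n → D ≤ (d n : ℝ) - s n := by
  have hβ : 0 < α - α' := sub_pos.2 hαα'
  have hdR : Tendsto (fun n => (d n : ℝ)) atTop atTop := tendsto_natCast_atTop_atTop.comp hd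
  have hsR : Tendsto (fun n => (s n : ℝ)) atTop atTop := tendsto_natCast_atTop_atTop.comp hs
  filter_upwards [ha, hsd, hdR.eventually_ge_atTop (2 * D), hdR.eventually_gt_atTop 0,
    hsR.eventually (eventually_sqrt_lt_tailCut_add hα' minCut_pos)] with n han hsdn hD hd0 hcut hk
  by_contra! hlt
  have h1 : (s n : ℝ) + 1 ≤ d n := by exact_mod_cast hsdn
  have h2 := minCut_le_tailCut hβ (by linarith : α - α' < 1)
    (show (1 : ℝ) ≤ (d n : ℝ) - s n by linarith)
  have h3 : √(2 * Real.log (d n)) ≤ √(2 * Real.log (2 * s n)) := by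
    gcongr
    linarith
  rw [kappaBar_eq] at hk
  linarith

theorem sqrt_two_mul_log_mono {β x y : ℝ} (hβ : 0 < β) (hx : 0 < x) (hxy : x ≤ y) :
    √(2 * Real.log (x / β)) ≤ √(2 * Real.log (y / β)) := by
  gcongr

theorem limsup_risk_MBar_moderate (hαα' : α' < α)
    (hd : Tendsto d atTop atTop) (hs : Tendsto s atTop atTop) (hsd : ∀ n, s n ≤ d n)
    (hσ : ∀ n, 0 < σ n)
    (hhigh : ∀ D : ℝ, ∀ᶠ n in atTop, kappaBar (d n) (s n) α α' ≤ a n / σ n →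
      D ≤ (d n : ℝ) - s n) :
    limsup (fun n => (MBar (d n) (s n) (a n) (σ n) α α' δ).risk (s n) (a n) (σ n) /
      ((σ n * √(2 * Real.log (d n)) : ℝ) : EReal)) atTop ≤ 1 := by
  have hβ : 0 < α - α' := sub_pos.2 hαα'
  have hdR : Tendsto (fun n => (d n : ℝ)) atTop atTop := tendsto_natCast_atTop_atTop.comp hd
  have hsR : Tendsto (fun n => (s n : ℝ)) atTop atTop := tendsto_natCast_atTop_atTop.comp hs
  obtain ⟨D, hD⟩ := eventually_atTop.1 (eventually_tailCut_le two_pos hβ)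
  refine limsup_risk_le_one (K := 0) hβ hd hσ ?_
  filter_upwards [hhigh D, hhigh 1, hsR.eventually_gt_atTop 0,
    hsR.eventually (eventually_tailCut_le two_pos hβ),
    hdR.eventually (eventually_tailCut_le one_pos hβ),
    hdR.eventually ((tendsto_tailCut one_pos hβ).eventually_ge_atTop (PhiInv δ))]
    with n hDn h1n hs0 hscut hdcut hq
  have hsd' : (s n : ℝ) ≤ d n := by exact_mod_cast hsd n
  rcases lt_or_ge (a n / σ n) (kappaBar (d n) (s n) α α') with h | h
  · refine (risk_MBar_le (hσ n) (selThreshold_low h) (uBar_low h) le_rfl ?_).trans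
      (EReal.coe_le_coe_iff.2 (mul_le_mul_of_nonneg_left (by linarith) (hσ n).le))
    rw [max_eq_right (by linarith), zero_mul]
  · refine (risk_MBar_le (hσ n) (selThreshold_high h) (uBar_high h) (le_max_right _ _)
      (mul_le_of_le_one_right (le_max_right _ _) (gaussianTail_le_one _))).trans
      (EReal.coe_le_coe_iff.2 (mul_le_mul_of_nonneg_left ?_ (hσ n).le))
    have h1 := hscut.trans (sqrt_two_mul_log_mono hβ hs0 hsd')
    have h2 := (hD _ (hDn h)).trans (sqrt_two_mul_log_mono (y := d n) hβ
      (by linarith [h1n h]) (by linarith))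
    rw [add_zero, ← max_add_add_left]
    apply max_le <;> linarith

theorem tailCut_add_max_le_kappaTilde {d s : ℕ} {C' : ℝ} (hα' : 0 < α') (hαα' : α' < α)
    (hα1 : α < 1) (hs : (1 : ℝ) < s) (hds : 1 < (d : ℝ) - s)
    (h2 : cutConst 2 - 2 * Real.log (α - α') ≤ C')
    (h1 : cutConst 1 - 2 * Real.log α' ≤ C') :
    tailCut 2 ((d : ℝ) - s) (α - α') + max (tailCut 1 s α') (xi d s) ≤ kappaTilde d s C' := by
  refine add_le_add (tailCut_le_sqrt two_pos (sub_pos.2 hαα') (by linarith) hds h2)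
    (max_le_max (tailCut_le_sqrt one_pos hα' (by linarith) hs h1) le_rfl)

/-- The role of `ξ`: the factor `exp (-ξ² / 2) ≤ √(log s / log (d - s))` in the probability of a
missed signal compensates the size `√(log (d - s))` of the selection threshold. -/
theorem mul_gaussianTail_le_two {d s : ℕ} {t v : ℝ} (hs : (1 : ℝ) < s) (hds : 1 < (d : ℝ) - s)
    (ht : t ≤ 2 * √(Real.log ((d : ℝ) - s))) (hv : √(Real.log s) ≤ v) (hxi : xi d s ≤ v) :
    t * gaussianTail v ≤ 2 := by
  have hl : 0 < Real.log s := Real.log_pos hs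
  have hr : 0 < Real.log ((d : ℝ) - s) := Real.log_pos hds
  have hl' := Real.sqrt_pos.2 hl
  have hr' := Real.sqrt_pos.2 hr
  have hv0 : 0 < v := hl'.trans_le hv
  have hexp : Real.exp (-v ^ 2 / 2) ≤ √(Real.log s) / √(Real.log ((d : ℝ) - s)) := by
    rw [← Real.sqrt_div' _ hr.le]
    apply Real.le_sqrt_of_sq_le
    rw [← Real.exp_nat_mul]
    have hxi2 : Real.log (Real.log ((d : ℝ) - s)) - Real.log (Real.log s) ≤ v ^ 2 := by
      have h0 : 0 ≤ xi d s := Real.sqrt_nonneg _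
      have h1 : xi d s ^ 2 =
          max (Real.log (Real.log ((d : ℝ) - s)) - Real.log (Real.log s)) 0 :=
        Real.sq_sqrt (le_max_right _ _)
      calc _ ≤ xi d s ^ 2 := h1 ▸ le_max_left _ _
        _ ≤ v ^ 2 := by gcongr
    calc Real.exp ((2 : ℕ) * (-v ^ 2 / 2))
        ≤ Real.exp (Real.log (Real.log s) - Real.log (Real.log ((d : ℝ) - s))) := by
          apply Real.exp_le_exp.2
          push_cast
          linarith
      _ = _ := by rw [Real.exp_sub, Real.exp_log hl, Real.exp_log hr]
  have hpi : 1 ≤ √(2 * Real.pi) := by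
    rw [Real.one_le_sqrt]
    linarith [Real.pi_gt_three]
  have htail : gaussianTail v ≤ (√(Real.log ((d : ℝ) - s)))⁻¹ := by
    refine (gaussianTail_le hv0).trans ?_
    rw [div_le_iff₀ (by positivity)]
    refine hexp.trans ?_
    rw [div_eq_inv_mul]
    gcongr
    exact hv.trans (le_mul_of_one_le_right hv0.le hpi)
  calc t * gaussianTail v ≤ 2 * √(Real.log ((d : ℝ) - s)) * (√(Real.log ((d : ℝ) - s)))⁻¹ :=
        mul_le_mul ht htail (gaussianTail_nonneg v) (by positivity)
    _ = 2 := by field_simp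

theorem limsup_risk_MBar_high (hα' : 0 < α') (hαα' : α' < α) (hα1 : α < 1)
    (hs : Tendsto s atTop atTop)
    (hds : Tendsto (fun n => (d n : ℝ) - s n) atTop atTop) (hσ : ∀ n, 0 < σ n)
    (hk : ∀ᶠ n in atTop, tailCut 2 ((d n : ℝ) - s n) (α - α') +
      max (tailCut 1 (s n) α') (xi (d n) (s n)) ≤ a n / σ n) :
    limsup (fun n => (MBar (d n) (s n) (a n) (σ n) α α' δ).risk (s n) (a n) (σ n) /
      ((σ n * √(2 * Real.log (s n)) : ℝ) : EReal)) atTop ≤ 1 := by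
  have hβ : 0 < α - α' := sub_pos.2 hαα'
  have hsR : Tendsto (fun n => (s n : ℝ)) atTop atTop := tendsto_natCast_atTop_atTop.comp hs
  refine limsup_risk_le_one (K := 2) hβ hs hσ ?_
  filter_upwards [hk, hsR.eventually_gt_atTop 1, hds.eventually_gt_atTop 1,
    hds.eventually_ge_atTop (α - α')⁻¹,
    hsR.eventually (eventually_tailCut_le two_pos hβ),
    hds.eventually (eventually_tailCut_le two_pos hβ),
    hsR.eventually (eventually_sqrt_log_le_tailCut one_pos hα')]
    with n hkn hs1 hds1 hdsβ hscut hdscut hlow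
  have hbar : kappaBar (d n) (s n) α α' ≤ a n / σ n := by
    rw [kappaBar_eq]
    linarith [le_max_left (tailCut 1 (s n) α') (xi (d n) (s n))]
  refine (risk_MBar_le (hσ n) (selThreshold_high hbar) (uBar_high hbar) zero_le_two ?_).trans
    (EReal.coe_le_coe_iff.2 (mul_le_mul_of_nonneg_left (by linarith) (hσ n).le))
  set t := tailCut 2 ((d n : ℝ) - s n) (α - α') with ht
  set v := a n / σ n - t with hv
  have hvmax : max (tailCut 1 (s n) α') (xi (d n) (s n)) ≤ v := by linarith
  have ht2 : t ≤ 2 * √(Real.log ((d n : ℝ) - s n)) := by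
    refine hdscut.trans ?_
    rw [show (2 : ℝ) = √(2 ^ 2) by rw [Real.sqrt_sq zero_le_two], ← Real.sqrt_mul (by positivity),
      Real.sqrt_sq zero_le_two, Real.log_div (by linarith) hβ.ne']
    apply Real.sqrt_le_sqrt
    have := Real.log_le_log (inv_pos.2 hβ) hdsβ
    rw [Real.log_inv] at this
    linarith
  have hlow' : √(Real.log (s n)) ≤ v := by
    refine le_trans (Real.sqrt_le_sqrt (Real.log_le_log (by linarith) ?_))
      (hlow.trans ((le_max_left _ _).trans hvmax))
    rw [le_div_iff₀ hα']
    nlinarith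
  have hmax : max (t - tailCut 2 (s n) (α - α')) 0 ≤ t :=
    max_le (by linarith [tailCut_nonneg 2 (s n) (α - α')]) (tailCut_nonneg _ _ _)
  exact (mul_le_mul_of_nonneg_right hmax (gaussianTail_nonneg v)).trans
    (mul_gaussianTail_le_two hs1 hds1 ht2 hlow' ((le_max_right _ _).trans hvmax))

end

end SparseCI

theorem mainTheorem5 (α δ γ : ℝ) (hα : 0 < α ∧ α < 1) (hδ : 0 < δ ∧ δ < 1)
    (hγ : 0 < γ ∧ γ < 1) :
    -- part (1): the moderate signal-to-noise ratio regime
    (∀ (d s : ℕ → ℕ) (a σ A : ℕ → ℝ),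
      Tendsto d atTop atTop → Tendsto s atTop atTop → (∀ n, s n ≤ d n) →
      (∀ n, 0 < a n) → (∀ n, 0 < σ n) →
      (∀ᶠ n in atTop, A n ≤ s n) → Tendsto A atTop atTop →
      Tendsto (fun n => (d n : ℝ) / A n) atTop atTop →
      (∀ᶠ n in atTop, kappaStarStar (s n) δ (γ * α) ≤ a n / σ n ∧
        a n / σ n ≤ √(2 * Real.log ((d n : ℝ) / A n - 1))) →
      (∀ M ∈ MPlus d s a σ α δ,
        1 ≤ liminf (fun n => (M n).risk (s n) (a n) (σ n) /
          ((σ n * √(2 * Real.log (d n)) / 2 : ℝ) : EReal)) atTop) ∧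
      (∀ c : ℕ → ℝ≥0∞, ENNReal.ofReal (1 - α) ≤ liminf c atTop →
        1 ≤ liminf (fun n => ⨅ M ∈ coverageClass (d n) (s n) (a n) (σ n) δ (c n),
          M.risk (s n) (a n) (σ n) /
            ((σ n * √(2 * Real.log (d n)) / 2 : ℝ) : EReal)) atTop) ∧
      ((∀ᶠ n in atTop, s n < d n) →
        (fun n => MBar (d n) (s n) (a n) (σ n) α (γ * α) δ) ∈ MPlus d s a σ α δ ∧
        limsup (fun n => (MBar (d n) (s n) (a n) (σ n) α (γ * α) δ).risk (s n) (a n) (σ n) /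
          ((σ n * √(2 * Real.log (d n)) : ℝ) : EReal)) atTop ≤ 1)) ∧
    -- part (2): the high signal-to-noise ratio regime
    (∃ C₀ : ℝ, 0 < C₀ ∧ ∀ C' : ℝ, C₀ ≤ C' →
      ∀ (d s : ℕ → ℕ) (a σ : ℕ → ℝ),
      Tendsto d atTop atTop → Tendsto s atTop atTop → (∀ n, s n ≤ d n) →
      Tendsto (fun n => (d n : ℝ) - s n) atTop atTop →
      (∀ n, 0 < a n) → (∀ n, 0 < σ n) →
      (∀ᶠ n in atTop, kappaTilde (d n) (s n) C' ≤ a n / σ n) →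
      (∀ M ∈ MPlus d s a σ α δ,
        1 ≤ liminf (fun n => (M n).risk (s n) (a n) (σ n) /
          ((σ n * √(2 * Real.log (s n)) / 2 : ℝ) : EReal)) atTop) ∧
      (∀ c : ℕ → ℝ≥0∞, ENNReal.ofReal (1 - α) ≤ liminf c atTop →
        1 ≤ liminf (fun n => ⨅ M ∈ coverageClass (d n) (s n) (a n) (σ n) δ (c n),
          M.risk (s n) (a n) (σ n) /
            ((σ n * √(2 * Real.log (s n)) / 2 : ℝ) : EReal)) atTop) ∧
      (fun n => MBar (d n) (s n) (a n) (σ n) α (γ * α) δ) ∈ MPlus d s a σ α δ ∧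
      limsup (fun n => (MBar (d n) (s n) (a n) (σ n) α (γ * α) δ).risk (s n) (a n) (σ n) /
        ((σ n * √(2 * Real.log (s n)) : ℝ) : EReal)) atTop ≤ 1) := by
  have hα'0 : 0 < γ * α := mul_pos hγ.1 hα.1
  have hαα' : γ * α < α := mul_lt_of_lt_one_left hα.1 hγ.2
  refine ⟨fun d s a σ A hd hs hsd ha hσ hAs hA hdA hk => ?_, ?_⟩
  · have hupper : ∀ᶠ n in atTop, a n / σ n ≤ √(2 * Real.log (d n)) := by
      filter_upwards [hk, hA.eventually_ge_atTop 1, hdA.eventually_gt_atTop 1] with n hn hAn hdn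
      refine hn.2.trans ?_
      have h0 : 0 < (d n : ℝ) / A n - 1 := by linarith
      have h1 : (d n : ℝ) / A n - 1 ≤ d n := by
        linarith [div_le_self (Nat.cast_nonneg (α := ℝ) (d n)) hAn]
      gcongr
    have hlower : ∀ c : ℕ → ℝ≥0∞, ENNReal.ofReal (1 - α) ≤ liminf c atTop → _ := fun c hc =>
      one_le_liminf_iInf_risk_moderate (δ := δ) hα.2 hd hs hσ hupper hc
    refine ⟨fun M hM => one_le_liminf_risk_of_MPlus hlower hM, hlower, fun hlt => ?_⟩
    have hhigh := eventually_le_sub_of_moderate hα'0 hαα' hα.2 hd hs hupper hlt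
    exact ⟨MBar_mem_MPlus hα'0 hαα' hδ.1 hδ.2 hd hs hsd ha hσ (hk.mono fun n hn _ => hn.1) hhigh,
      limsup_risk_MBar_moderate hαα' hd hs hsd hσ hhigh⟩
  · refine ⟨max 1 (max (cutConst 2 - 2 * Real.log (α - γ * α)) (cutConst 1 - 2 * Real.log (γ * α))),
      lt_max_of_lt_left one_pos, fun C' hC' d s a σ hd hs hsd hds ha hσ hk => ?_⟩
    have hC2 := (le_max_left _ _).trans ((le_max_right _ _).trans hC')
    have hC1 := (le_max_right _ _).trans ((le_max_right _ _).trans hC')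
    have hlower : ∀ c : ℕ → ℝ≥0∞, ENNReal.ofReal (1 - α) ≤ liminf c atTop → _ := fun c hc =>
      one_le_liminf_iInf_risk_high (δ := δ) hα.2 hs hsd ha hσ hc
    have hcut : ∀ᶠ n in atTop, tailCut 2 ((d n : ℝ) - s n) (α - γ * α) +
        max (tailCut 1 (s n) (γ * α)) (xi (d n) (s n)) ≤ a n / σ n := by
      filter_upwards [hk, (tendsto_natCast_atTop_atTop.comp hs).eventually_gt_atTop (1 : ℝ),
        hds.eventually_gt_atTop 1] with n hn hs1 hds1
      exact (tailCut_add_max_le_kappaTilde hα'0 hαα' hα.2 hs1 hds1 hC2 hC1).trans hn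
    refine ⟨fun M hM => one_le_liminf_risk_of_MPlus hlower hM, hlower,
      MBar_mem_MPlus hα'0 hαα' hδ.1 hδ.2 hd hs hsd ha hσ ?_
        fun D => (hds.eventually_ge_atTop D).mono fun n hn _ => hn,
      limsup_risk_MBar_high hα'0 hαα' hα.2 hs hds hσ hcut⟩
    -- the first branch of the construction does not occur
    filter_upwards [hcut] with n hn hlt
    rw [kappaBar_eq] at hlt
    linarith [le_max_left (tailCut 1 (s n) (γ * α)) (xi (d n) (s n))]
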